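/- **Data.** Let $\Bbbk$ be a field with an automorphism $k\mapsto\overline k$ with $\overline{\overline k}=k$. *$\mathcal G$-LW data* consist of the following. 1. An abelian group $\mathcal G$ and a subset $\mathcal X\subset\mathcal G$ with $-\mathcal X=\mathcal X$ and $\mathcal G\not\subset Y+\mathcal X$ for every finite $Y\subset\mathcal G$; elements of $\mathcal G\setminus\mathcal X$ are called generic. For each generic $g$ a finite set $I_g$; put $\mathsf A=\bigsqcup_{g\notin\mathcal X} I_g$ and $|j|=g$ for $j\in I_g$. An involution $*$ on $\mathsf A$ with $I_g^*=I_{-g}$. 2. $\delta:\mathsf A^3\to\mathbb N$ with $\delta_{ijk}=\delta_{jki}=\delta_{k^*j^*i^*}$ and $\delta_{ijk}=0$ unless $|i|+|j|+|k|=0$. 3. Maps $\mathsf d,\mathsf b,\beta:\mathsf A\to\Bbbk^*$, invariant under $*$ and with values fixed by the bar, such that for all $g_1,g_2\notin\mathcal X$ and all $j\in\mathsf A$ with $|j|=g_1+g_2$, $\mathsf b(j)=\sum_{j_1\in I_{g_1},\,j_2\in I_{g_2}}\mathsf b(j_1)\mathsf b(j_2)\,\delta_{j^*j_1j_2}$.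 4. $\gamma:\mathsf A^3\times\mathbb N\to\Bbbk^*$ with $\overline\gamma=\gamma$, $\gamma^n_{i,j,k}=\gamma^n_{j,k,i}$ and $\gamma^n_{i,j,k}\gamma^n_{k^*,j^*,i^*}\beta(i)\beta(j)\beta(k)=1$ for $1\le n\le\delta_{ijk}$. 5. $N:\mathsf A^6\times\mathbb N^4\to\Bbbk$, where $N^{j_1j_2j_3}_{j_4j_5j_6}(^{a_1a_2}_{a_3a_4})=0$ unless $1\le a_1\le\delta_{j_1j_2j_3^*}$, $1\le a_2\le\delta_{j_3j_4j_5^*}$, $1\le a_3\le\delta_{j_5j_6^*j_1^*}$, $1\le a_4\le\delta_{j_6j_4^*j_2^*}$, such that (sums run over all labels giving nonzero terms, a finite set) $$N^{j_1 j_2 j_3}_{j_4 j_5 j_6}(^{a_1a_2}_{a_3a_4})= N^{j_2 j_3^*j_1^* }_{j_5 j_6j_4 }(^{a_1a_3}_{a_4a_2})= N^{j_3 j_4 j_5}_{j_6^* j_1 j_2^*}(^{a_2a_3}_{a_1a_4});$$ if $|j_2|+|j_3|\notin\mathcal X$, then $$\sum_{j,c_1,c_2,c_3}\mathsf d(j)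 N^{j_1 j_2 j_5}_{j_3 j_6 j}(^{a_1a_2}_{c_1c_2}) N^{j_1 j j_6}_{j_4 j_0 j_7}(^{c_1a_3}_{a_0c_3}) N^{j_2 j_3 j}_{j_4 j_7 j_8}(^{c_2c_3}_{a_4a_5})= \sum_{c_4}N^{j_5 j_3 j_6}_{j_4 j_0 j_8}(^{a_2a_3}_{c_4a_5}) N^{j_1 j_2 j_5}_{j_8 j_0 j_7}(^{a_1c_4}_{a_0a_4});$$ if $|j|+|l|\notin\mathcal X$, $1\le a_1\le\delta_{ijp^*}$ and $1\le a_2\le\delta_{plm^*}$, then $$\sum_{n,a_3,a_4}\mathsf d(n) N^{i j p}_{l m n}(^{a_1a_2}_{a_3a_4}) N^{k j^{*} i}_{n m l}(^{a'_1a_3}_{a'_2a_4}) = \frac{\delta_{k,p}\,\delta_{a_1,a'_1}\delta_{a_2,a'_2}}{\mathsf d(k)};$$ and $$\overline{N^{j_1 j_2 j_3 }_{j_4j_5j_6}(^{a_1a_2}_{a_3a_4})}= N^{j_2^{*} j_1^{*} j_3^{*}}_{j_5j_4j_6}(^{a_1a_2}_{a_4a_3})\,\gamma^{a_1}_{j_1,j_2,j_3^{*}}\gamma^{a_2}_{j_3,j_4,j_5^{*}}\gamma^{a_3}_{j_1^{*},j_5,j_6^{*}}\gamma^{a_4}_{j_2^{*},j_6,j_4^{*}}\prod_{i=1}^6\beta(j_i).$$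 **State space.** Let $\Sigma$ be a closed connected oriented surface with a (simplicial) triangulation, and $\Gamma$ the dual trivalent graph, whose vertices carry the cyclic order of their edges given by the orientation. Plaquettes are the components of $\Sigma\setminus\Gamma$, i.e. the vertices of the triangulation. A *$\mathcal G$-coloring* is a map $\Phi$ from oriented edges of $\Gamma$ to $\mathcal G$ with $\Phi(-e)=-\Phi(e)$ and $\Phi(e_1)+\Phi(e_2)+\Phi(e_3)=0$ for the three edges oriented towards any vertex; it is *admissible* if it takes only generic values. A *state* $\sigma$ of an admissible $\Phi$ assigns to each oriented edge $e$ some $\sigma(e)\in I_{\Phi(e)}$ with $\sigma(-e)=\sigma(e)^*$, and to each vertex $v$ an integer $0\le\sigma_0(v)\le\delta_{\sigma(e_1)\sigma(e_2)\sigma(e_3)}$, where $e_1,e_2,e_3$ are the cyclically ordered edges at $v$, oriented towards $v$. Let $\mathcal H(\Gamma,\Phi)$ be the $\Bbbk$-vector space with basis the states $|\Gamma,\sigma\rangle$, and define on it the form, semilinear in the first and linear in the second variable, with $$\langle\Gamma,\sigma\mid\Gamma,\sigma'\rangle=\delta_{\sigma,\sigma'}\,\frac{\prod_{v}\gamma^{\sigma_0(v)}_{\sigma(e_1),\sigma(e_2),\sigma(e_3)}\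 \prod_{e}\beta(\sigma(e))}{\prod_{e}\mathsf d(\sigma(e))}$$ (products over the vertices and the unoriented edges of $\Gamma$). **Plaquette operators.** For a plaquette $p$ and $g\in\mathcal G$ let $g.\delta p$ be the coloring equal to $g$ on the edges of $\partial p$ with the boundary orientation, $-g$ on their opposites, and $0$ on other edges. Let $\Phi$ and $\Phi+g.\delta p$ be admissible, $g$ generic and $s\in I_g$. Number the $n$ sides of $p$ cyclically along the direction opposite to the boundary orientation, and orient them in that direction; let $j_i$ be the label of the $i$-th side in $\sigma$, let $C_i$ be the label of the vertex between sides $i$ and $i+1$, and $k_i$ the label of the third edge at that vertex, oriented away from it (so the cyclically ordered inward labels there are $j_i,j_{i+1}^*,k_i^*$). Then $B_p^s:\mathcal H(\Gamma,\Phi)\to\mathcal H(\Gamma,\Phi+g.\delta p)$ is $$B_p^s|\Gamma,\sigma\rangle=\sum_{j'_i,\,A_i,\,C'_i}\ \prod_{i=1}^n\mathsf d(j'_i)\,N^{j'_i\,s\,j_i}_{j_{i+1}^*\,k_i\,j_{i+1}'^{*}}(^{A_i\,C_i}_{C'_i\,A_{i+1}})\ |\Gamma,\sigma'\rangle ,$$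 where $\sigma'$ is obtained from $\sigma$ by replacing $j_i,C_i$ by $j'_i,C'_i$. Put $B_p^g=\sum_{s\in I_g}\mathsf b(s)B_p^s$. If $\Phi$ is admissible, call $g$ *generic for $(\Phi,p)$* if $g\notin\mathcal X$ and $\Phi-g.\delta p$ is admissible; for such $g$ put $B_p=B_p^{g}B_p^{-g}:\mathcal H(\Gamma,\Phi)\to\mathcal H(\Gamma,\Phi-g.\delta p)\to\mathcal H(\Gamma,\Phi)$. **Theorem.** Let $\Phi$ be an admissible coloring. For every plaquette $p$ there is a $g$ that is generic for $(\Phi,p)$, and $B_p$ does not depend on the choice of such $g$. Moreover: 1. $B_p^2=B_p$ for every plaquette $p$; 2. $B_pB_{p'}=B_{p'}B_p$ for all plaquettes $p,p'$; 3. $\langle\psi\mid B_p\phi\rangle=\langle B_p\psi\mid\phi\rangle$ for every plaquette $p$ and all $\psi,\phi\in\mathcal H(\Gamma,\Phi)$. -/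

import Mathlib

open scoped Pointwise

/-! ## Algebraic input -/

/-- Generically graded labels: a small symmetric set `X` in an abelian group `G`, the disjoint
union `A` of the finite sets `I_g` indexed by the generic elements `g ∈ G ∖ X` (encoded by the
degree map `deg : A → G`), and an involution `dual` on `A` exchanging `I_g` and `I_{-g}`. -/
structure GradedLabels (G : Type*) [AddCommGroup G] where
  X : Set G
  X_symm : -X = X
  X_small : ∀ Y : Set G, Y.Finite → ¬ (Set.univ ⊆ Y + X)
  A : Type*
  deg : A → G
  deg_generic : ∀ a, deg a ∉ X
  finite_deg : ∀ g, {a | deg a = g}.Finite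
  dual : A → A
  dual_dual : ∀ a, dual (dual a) = a
  deg_dual : ∀ a, deg (dual a) = -deg a

namespace GradedLabels

variable {G : Type*} [AddCommGroup G] (L : GradedLabels G)

/-- The finite set `I_g` of labels of degree `g`. -/
noncomputable def I (g : G) : Finset L.A := (L.finite_deg g).toFinset

end GradedLabels

open Classical in
/-- `G`-LW data over a field `𝕜` whose involutive automorphism is `star`.

`N j₁ j₂ j₃ j₄ j₅ j₆ a₁ a₂ a₃ a₄` is the modified `6j` symbol with string labels `j₁ j₂ j₃` (top
row), `j₄ j₅ j₆` (bottom row) and branching labels `a₁ a₂` (top), `a₃ a₄` (bottom).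
A branching label at a vertex with inward labels `i, j, k` ranges over `1, …, δ i j k`.

In `pentagon` and `orthogonality` the summed string label has the degree forced by the support
of `N` (all other terms vanish); the identities are required when that degree is generic. -/
structure LWData (𝕜 : Type*) [Field 𝕜] [StarRing 𝕜] (G : Type*) [AddCommGroup G] extends
    GradedLabels G where
  /-- Fusion multiplicities. -/
  δ : A → A → A → ℕ
  δ_rotate : ∀ i j k, δ i j k = δ j k i
  δ_dual : ∀ i j k, δ i j k = δ (dual k) (dual j) (dual i)
  δ_deg : ∀ i j k, deg i + deg j + deg k ≠ 0 → δ i j k = 0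
  /-- Modified dimension. -/
  d : A → 𝕜
  d_ne_zero : ∀ i, d i ≠ 0
  star_d : ∀ i, star (d i) = d i
  d_dual : ∀ i, d (dual i) = d i
  b : A → 𝕜
  b_ne_zero : ∀ i, b i ≠ 0
  star_b : ∀ i, star (b i) = b i
  b_dual : ∀ i, b (dual i) = b i
  b_fusion : ∀ g₁ g₂ : G, g₁ ∉ X → g₂ ∉ X → ∀ j, deg j = g₁ + g₂ →
    b j = ∑ j₁ ∈ toGradedLabels.I g₁, ∑ j₂ ∈ toGradedLabels.I g₂,
      b j₁ * b j₂ * (δ (dual j) j₁ j₂ : 𝕜)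
  β : A → 𝕜
  β_ne_zero : ∀ i, β i ≠ 0
  star_β : ∀ i, star (β i) = β i
  β_dual : ∀ i, β (dual i) = β i
  γ : A → A → A → ℕ → 𝕜
  γ_ne_zero : ∀ i j k n, γ i j k n ≠ 0
  star_γ : ∀ i j k n, star (γ i j k n) = γ i j k n
  γ_rotate : ∀ i j k n, γ i j k n = γ j k i n
  γ_theta : ∀ i j k n, 1 ≤ n → n ≤ δ i j k →
    γ i j k n * γ (dual k) (dual j) (dual i) n * β i * β j * β k = 1
  /-- Modified `6j` symbols. -/
  N : A → A → A → A → A → A → ℕ → ℕ → ℕ → ℕ → 𝕜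
  N_support : ∀ j₁ j₂ j₃ j₄ j₅ j₆ a₁ a₂ a₃ a₄,
    ¬ ((1 ≤ a₁ ∧ a₁ ≤ δ j₁ j₂ (dual j₃)) ∧ (1 ≤ a₂ ∧ a₂ ≤ δ j₃ j₄ (dual j₅)) ∧
      (1 ≤ a₃ ∧ a₃ ≤ δ j₅ (dual j₆) (dual j₁)) ∧
      (1 ≤ a₄ ∧ a₄ ≤ δ j₆ (dual j₄) (dual j₂))) →
    N j₁ j₂ j₃ j₄ j₅ j₆ a₁ a₂ a₃ a₄ = 0
  N_symm₁ : ∀ j₁ j₂ j₃ j₄ j₅ j₆ a₁ a₂ a₃ a₄,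
    N j₁ j₂ j₃ j₄ j₅ j₆ a₁ a₂ a₃ a₄ = N j₂ (dual j₃) (dual j₁) j₅ j₆ j₄ a₁ a₃ a₄ a₂
  N_symm₂ : ∀ j₁ j₂ j₃ j₄ j₅ j₆ a₁ a₂ a₃ a₄,
    N j₁ j₂ j₃ j₄ j₅ j₆ a₁ a₂ a₃ a₄ = N j₃ j₄ j₅ (dual j₆) j₁ (dual j₂) a₂ a₃ a₁ a₄
  pentagon : ∀ j₀ j₁ j₂ j₃ j₄ j₅ j₆ j₇ j₈ a₀ a₁ a₂ a₃ a₄ a₅, deg j₂ + deg j₃ ∉ X →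
    (∑ j ∈ toGradedLabels.I (deg j₂ + deg j₃),
      ∑ c₁ ∈ Finset.Icc 1 (δ j₁ j (dual j₆)), ∑ c₂ ∈ Finset.Icc 1 (δ j₂ j₃ (dual j)),
      ∑ c₃ ∈ Finset.Icc 1 (δ j j₄ (dual j₇)),
        d j * N j₁ j₂ j₅ j₃ j₆ j a₁ a₂ c₁ c₂ * N j₁ j j₆ j₄ j₀ j₇ c₁ a₃ a₀ c₃ *
          N j₂ j₃ j j₄ j₇ j₈ c₂ c₃ a₄ a₅) =
    ∑ c₄ ∈ Finset.Icc 1 (δ j₅ j₈ (dual j₀)),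
      N j₅ j₃ j₆ j₄ j₀ j₈ a₂ a₃ c₄ a₅ * N j₁ j₂ j₅ j₈ j₀ j₇ a₁ c₄ a₀ a₄
  orthogonality : ∀ i j k l m p a₁ a₂ a₁' a₂', deg j + deg l ∉ X →
    (1 ≤ a₁ ∧ a₁ ≤ δ i j (dual p)) → (1 ≤ a₂ ∧ a₂ ≤ δ p l (dual m)) →
    ∑ n ∈ toGradedLabels.I (deg j + deg l), ∑ a₃ ∈ Finset.Icc 1 (δ i n (dual m)),
      ∑ a₄ ∈ Finset.Icc 1 (δ j l (dual n)),
        d n * N i j p l m n a₁ a₂ a₃ a₄ * N k (dual j) i n m l a₁' a₃ a₂' a₄ =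
      if k = p ∧ a₁ = a₁' ∧ a₂ = a₂' then 1 / d k else 0
  star_N : ∀ j₁ j₂ j₃ j₄ j₅ j₆ a₁ a₂ a₃ a₄,
    star (N j₁ j₂ j₃ j₄ j₅ j₆ a₁ a₂ a₃ a₄) =
      N (dual j₂) (dual j₁) (dual j₃) j₅ j₄ j₆ a₁ a₂ a₄ a₃ *
        γ j₁ j₂ (dual j₃) a₁ * γ j₃ j₄ (dual j₅) a₂ * γ (dual j₁) j₅ (dual j₆) a₃ *
        γ (dual j₂) j₆ (dual j₄) a₄ * (β j₁ * β j₂ * β j₃ * β j₄ * β j₅ * β j₆)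

/-! ## Triangulated surfaces and their dual graphs -/

/-- A triangulation, with vertex set `V`, of a closed connected oriented surface:
`tri a b c` says that `a, b, c` span a triangle and that their cyclic order is the positive one.
Each edge lies in exactly two triangles, which induce opposite orientations on it, and the link
of each vertex is a single cycle. -/
structure TriangulatedSurface (V : Type*) where
  tri : V → V → V → Prop
  tri_rotate : ∀ {a b c}, tri a b c → tri b c a
  tri_ne : ∀ {a b c}, tri a b c → a ≠ b
  /-- A set of three vertices spans at most one triangle, with one orientation. -/
  tri_not_swap : ∀ {a b c}, tri a b c → ¬ tri b a c
  tri_unique : ∀ {a b c c'}, tri a b c → tri a b c' → c = c'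
  tri_opposite : ∀ {a b c}, tri a b c → ∃ c', tri b a c'
  exists_tri : ∀ a, ∃ b c, tri a b c
  link_connected : ∀ {v b c b' c'}, tri v b c → tri v b' c' → Relation.ReflTransGen (tri v) b b'
  connected : ∀ v w, Relation.ReflTransGen (fun a b => ∃ c, tri a b c) v w
  nonempty : Nonempty V

namespace TriangulatedSurface

variable {V : Type*} (S : TriangulatedSurface V)

/-- The 1-skeleton of the triangulation. -/
def graph : SimpleGraph V where
  Adj a b := ∃ c, S.tri a b c
  symm := ⟨fun _ _ ⟨_, h⟩ => S.tri_opposite h⟩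
  loopless := ⟨fun _ ⟨_, h⟩ => S.tri_ne h rfl⟩

/-- Oriented edges of the dual graph `Γ`. The dart `(a, b)` of the 1-skeleton stands for the edge
of `Γ` crossing `ab`, oriented *towards* the (dual vertex of the) triangle `a b c` that is positively
oriented by `a, b, c`. So the edges at the dual vertex of `tri a b c`, oriented towards it, are
`(a, b)`, `(b, c)`, `(c, a)` in the cyclic order given by the orientation, and orientation reversal
of edges of `Γ` is `SimpleGraph.Dart.symm`. -/
abbrev OEdge : Type _ := S.graph.Dart

/-- Positively oriented triangles with a chosen first vertex. -/
abbrev Flag : Type _ := {x : V × V × V // S.tri x.1 x.2.1 x.2.2}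

/-- The first of the three edges of `Γ` at a trivalent vertex, oriented towards it. -/
def Flag.e₁ {S : TriangulatedSurface V} (f : S.Flag) : S.OEdge :=
  ⟨(f.1.1, f.1.2.1), ⟨_, f.2⟩⟩

/-- The second edge at the vertex. -/
def Flag.e₂ {S : TriangulatedSurface V} (f : S.Flag) : S.OEdge :=
  ⟨(f.1.2.1, f.1.2.2), ⟨_, S.tri_rotate f.2⟩⟩

/-- The third edge at the vertex. -/
def Flag.e₃ {S : TriangulatedSurface V} (f : S.Flag) : S.OEdge :=
  ⟨(f.1.2.2, f.1.1), ⟨_, S.tri_rotate (S.tri_rotate f.2)⟩⟩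

/-- Triangles, that is, vertices of `Γ`, as sets of three vertices of the triangulation. -/
abbrev Face [DecidableEq V] : Type _ :=
  {t : Finset V // ∃ f : S.Flag, ({f.1.1, f.1.2.1, f.1.2.2} : Finset V) = t}

/-- The triangle underlying a flag. -/
def Flag.face {S : TriangulatedSurface V} [DecidableEq V] (f : S.Flag) : S.Face :=
  ⟨{f.1.1, f.1.2.1, f.1.2.2}, f, rfl⟩

/-- A flag of a triangle; any other is obtained by rotating it. -/
noncomputable def Face.rep {S : TriangulatedSurface V} [DecidableEq V] (t : S.Face) : S.Flag :=
  t.2.choose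

/-- Unoriented edges of `Γ`. -/
abbrev UEdge : Type _ := {e : Sym2 V // e ∈ S.graph.edgeSet}

/-- An orientation of an edge of `Γ`. -/
noncomputable def UEdge.rep {S : TriangulatedSurface V} (e : S.UEdge) : S.OEdge :=
  ⟨(Quot.out e.1), by
    have h := e.2
    rw [← Quot.out_eq e.1] at h
    exact h⟩

/-- Sides of the plaquette dual to the vertex `p`: the vertices adjacent to `p`. -/
abbrev Side (p : V) : Type _ := {w : V // S.graph.Adj w p}

/-- The edge of `Γ` crossing `wp`, oriented against the boundary orientation of the plaquette
`p`. -/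
def Side.edge {S : TriangulatedSurface V} {p : V} (w : S.Side p) : S.OEdge := ⟨(w.1, p), w.2⟩

/-- Vertices of `Γ` on the boundary of the plaquette `p`: positively oriented triangles
`p, w, u`. -/
abbrev Corner (p : V) : Type _ := {x : V × V // S.tri p x.1 x.2}

section Corner

variable {S : TriangulatedSurface V} {p : V} (c : S.Corner p)

/-- For the corner `p, w, u`: the side `u`, the incoming one for the traversal of the boundary by
the edges `Side.edge`. -/
def Corner.sideIn : S.Side p := ⟨c.1.2, _, S.tri_rotate (S.tri_rotate c.2)⟩

/-- For the corner `p, w, u`: the side `w`, the outgoing one. -/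
def Corner.sideOut : S.Side p := ⟨c.1.1, S.tri_opposite c.2⟩

/-- For the corner `p, w, u`: the third edge of `Γ` at this vertex, oriented away from it. -/
def Corner.outer : S.OEdge := ⟨(c.1.2, c.1.1), S.tri_opposite (S.tri_rotate c.2)⟩

/-- The triangle at a corner. -/
def Corner.face [DecidableEq V] : S.Face := Flag.face ⟨(p, c.1.1, c.1.2), c.2⟩

end Corner

section Finiteness

variable [Fintype V]

instance : Finite S.OEdge := Finite.of_injective (fun e : S.OEdge => e.toProd)
  (SimpleGraph.Dart.toProd_injective)

noncomputable instance [DecidableEq V] : Fintype S.Face := Fintype.ofFinite _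
noncomputable instance : Fintype S.UEdge := Fintype.ofFinite _
noncomputable instance (p : V) : Fintype (S.Side p) := Fintype.ofFinite _
noncomputable instance (p : V) : Fintype (S.Corner p) := Fintype.ofFinite _
noncomputable instance (p : V) : DecidableEq (S.Side p) := Classical.decEq _

end Finiteness

/-! ## Colorings -/

/-- `G`-colorings of the dual graph. -/
@[ext]
structure Coloring (G : Type*) [AddCommGroup G] where
  val : S.OEdge → G
  val_symm : ∀ e, val e.symm = -val e
  val_vertex : ∀ f : S.Flag, val f.e₁ + val f.e₂ + val f.e₃ = 0

variable {S}

instance {G : Type*} [AddCommGroup G] : Add (S.Coloring G) where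
  add Φ Ψ :=
    { val := fun e => Φ.val e + Ψ.val e
      val_symm := fun e => by rw [Φ.val_symm, Ψ.val_symm]; abel
      val_vertex := fun f => by
        have h₁ := Φ.val_vertex f
        have h₂ := Ψ.val_vertex f
        calc _ = (Φ.val f.e₁ + Φ.val f.e₂ + Φ.val f.e₃) +
              (Ψ.val f.e₁ + Ψ.val f.e₂ + Ψ.val f.e₃) := by abel
          _ = 0 := by rw [h₁, h₂, add_zero] }

variable (S) in
/-- The coloring `g.δp`: it is `g` on the boundary edges `(p, w)` of the plaquette `p`, oriented
as the boundary of `p`, `-g` on their opposites `(w, p)`, and `0` on all other edges. -/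
def plaquetteColoring [DecidableEq V] {G : Type*} [AddCommGroup G] (g : G) (p : V) :
    S.Coloring G where
  val e := if e.fst = p then g else if e.snd = p then -g else 0
  val_symm e := by
    have := e.fst_ne_snd
    by_cases h₁ : e.fst = p <;> by_cases h₂ : e.snd = p <;> simp_all
  val_vertex f := by
    obtain ⟨⟨a, b, c⟩, h⟩ := f
    have h₁ : a ≠ b := S.tri_ne h
    have h₂ : b ≠ c := S.tri_ne (S.tri_rotate h)
    have h₃ : c ≠ a := S.tri_ne (S.tri_rotate (S.tri_rotate h))
    by_cases ha : a = p
    · subst ha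
      simp [Flag.e₁, Flag.e₂, Flag.e₃, h₁.symm, h₃]
    · by_cases hb : b = p
      · subst hb
        simp [Flag.e₁, Flag.e₂, Flag.e₃, h₁, h₂.symm]
      · by_cases hc : c = p
        · subst hc
          simp [Flag.e₁, Flag.e₂, Flag.e₃, h₂, h₃.symm]
        · simp [Flag.e₁, Flag.e₂, Flag.e₃, ha, hb, hc]

end TriangulatedSurface

/-! ## State spaces and operators -/

namespace LWData

open TriangulatedSurface

variable {𝕜 : Type*} [Field 𝕜] [StarRing 𝕜] {G : Type*} [AddCommGroup G] (D : LWData 𝕜 G)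
  {V : Type*} [DecidableEq V] {S : TriangulatedSurface V}

/-- A coloring is admissible if it takes only generic values. -/
def Admissible (Φ : S.Coloring G) : Prop := ∀ e, Φ.val e ∉ D.X

/-- States of a coloring. The value `vert t = 0` is the one that violates the branching rule. -/
@[ext]
structure State (Φ : S.Coloring G) where
  edge : S.OEdge → D.A
  vert : S.Face → ℕ
  deg_edge : ∀ e, D.deg (edge e) = Φ.val e
  edge_symm : ∀ e, edge e.symm = D.dual (edge e)
  vert_le : ∀ f : S.Flag, vert f.face ≤ D.δ (edge f.e₁) (edge f.e₂) (edge f.e₃)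

instance [Fintype V] (Φ : S.Coloring G) : Finite (D.State Φ) := by
  classical
  have hfin : ∀ g, Finite {a : D.A // D.deg a = g} := fun g => (D.finite_deg g).to_subtype
  let E := ∀ e : S.OEdge, {a : D.A // D.deg a = Φ.val e}
  have hE : Finite E := Pi.finite
  let F := Σ x : E, ∀ t : S.Face,
    Fin (D.δ (x t.rep.e₁).1 (x t.rep.e₂).1 (x t.rep.e₃).1 + 1)
  have hF : Finite F := inferInstance
  have hrep : ∀ t : S.Face, Flag.face t.rep = t := fun t => Subtype.ext t.2.choose_spec
  let φ : D.State Φ → F := fun σ => ⟨fun e => ⟨σ.edge e, σ.deg_edge e⟩, fun t =>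
    ⟨σ.vert t, by
      have h := σ.vert_le t.rep
      rw [hrep] at h
      exact Nat.lt_succ_of_le h⟩⟩
  refine Finite.of_injective φ fun σ τ h => ?_
  have h₁ : σ.edge = τ.edge := by
    have := (Sigma.mk.inj_iff.mp h).1
    funext e
    exact congrArg Subtype.val (congrFun this e)
  obtain ⟨e, v, _, _, _⟩ := σ
  obtain ⟨e', v', _, _, _⟩ := τ
  obtain rfl : e = e' := h₁
  have h₂ := eq_of_heq (Sigma.mk.inj_iff.mp h).2
  have h₃ : v = v' := by
    funext t
    exact congrArg Fin.val (congrFun h₂ t)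
  subst h₃
  rfl

noncomputable instance [Fintype V] (Φ : S.Coloring G) : Fintype (D.State Φ) := Fintype.ofFinite _

/-- The state space `H(Γ, Φ)`: vectors `∑ σ, ψ σ |Γ, σ⟩`. -/
abbrev StateSpace (Φ : S.Coloring G) : Type _ := D.State Φ → 𝕜

section Form

variable {D} {Φ : S.Coloring G}

/-- `γ(σ(v))`, computed from a flag of the triangle dual to `v`. -/
def State.flagγ (σ : D.State Φ) (f : S.Flag) : 𝕜 :=
  D.γ (σ.edge f.e₁) (σ.edge f.e₂) (σ.edge f.e₃) (σ.vert f.face)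

/-- `γ(σ(v))` does not depend on the flag. -/
theorem State.flagγ_eq (σ : D.State Φ) {f f' : S.Flag} (h : f.face = f'.face) :
    σ.flagγ f = σ.flagγ f' := by
  unfold State.flagγ
  rw [h]
  obtain ⟨⟨a, b, c⟩, hf⟩ := f
  obtain ⟨⟨a', b', c'⟩, hf'⟩ := f'
  have h₁ : a ≠ b := S.tri_ne hf
  have h₂ : b ≠ c := S.tri_ne (S.tri_rotate hf)
  have h₃ : c ≠ a := S.tri_ne (S.tri_rotate (S.tri_rotate hf))
  have h₁' : a' ≠ b' := S.tri_ne hf'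
  have h₂' : b' ≠ c' := S.tri_ne (S.tri_rotate hf')
  have h₃' : c' ≠ a' := S.tri_ne (S.tri_rotate (S.tri_rotate hf'))
  have hset : ({a, b, c} : Finset V) = {a', b', c'} := congrArg Subtype.val h
  have ha : a' ∈ ({a, b, c} : Finset V) := by rw [hset]; simp
  have hb : b' ∈ ({a, b, c} : Finset V) := by rw [hset]; simp
  have hc : c' ∈ ({a, b, c} : Finset V) := by rw [hset]; simp
  simp only [Finset.mem_insert, Finset.mem_singleton] at ha hb hc
  rcases ha with rfl | rfl | rfl <;> rcases hb with rfl | rfl | rfl <;>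
    rcases hc with rfl | rfl | rfl <;>
    first
    | exact absurd rfl h₁'
    | exact absurd rfl h₂'
    | exact absurd rfl h₃'
    | rfl
    | exact D.γ_rotate _ _ _ _
    | exact (D.γ_rotate _ _ _ _).symm
    | exact absurd (S.tri_rotate hf') (S.tri_not_swap hf)
    | exact absurd (S.tri_rotate (S.tri_rotate hf')) (S.tri_not_swap hf)
    | exact absurd hf' (S.tri_not_swap hf)

variable [Fintype V]

/-- The norm of `|Γ, σ⟩`: `∏_v γ(σ(v)) ∏_e β(σ(e)) / ∏_e d(σ(e))`. It does not depend on the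
chosen representatives, because `γ` is invariant by rotation and `β`, `d` by duality. -/
noncomputable def State.weight (σ : D.State Φ) : 𝕜 :=
  (∏ v : S.Face, σ.flagγ v.rep) * (∏ e : S.UEdge, D.β (σ.edge e.rep)) /
    ∏ e : S.UEdge, D.d (σ.edge e.rep)

variable (D) in
/-- The indefinite inner product on `H(Γ, Φ)`. -/
noncomputable def form (ψ φ : D.StateSpace Φ) : 𝕜 :=
  ∑ σ : D.State Φ, star (ψ σ) * σ.weight * φ σ

end Form

/-- `σ` and `σ'` agree on all edges that are not sides of the plaquette `p` and on all vertices of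
`Γ` that do not lie on the boundary of `p`. -/
def AgreeOff (p : V) {Φ Φ' : S.Coloring G} (σ : D.State Φ) (σ' : D.State Φ') : Prop :=
  (∀ e : S.OEdge, e.fst ≠ p → e.snd ≠ p → σ'.edge e = σ.edge e) ∧
    ∀ t : S.Face, p ∉ t.1 → σ'.vert t = σ.vert t

variable [Fintype V]

open Classical in
/-- The coefficient of `|Γ, σ'⟩` in `B_p^s |Γ, σ⟩`. With the sides numbered `1, …, n` along the
edges `Side.edge`, with labels `j_i` in `σ` and `j'_i` in `σ'`, and with outer labels `k_i` and
vertex labels `C_i`, `C'_i`, it is the sum over `1 ≤ A_i ≤ δ(j'_i, s, j_i*)` of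
`∏ i, d(j'_i) N^{j'_i s j_i}_{j_{i+1}* k_i j'_{i+1}*}(A_i C_i; C'_i A_{i+1})`. -/
noncomputable def stringCoeff (p : V) (s : D.A) {Φ Φ' : S.Coloring G} (σ' : D.State Φ')
    (σ : D.State Φ) : 𝕜 :=
  if D.AgreeOff p σ σ' then
    ∑ a ∈ Fintype.piFinset fun w : S.Side p =>
        Finset.Icc 1 (D.δ (σ'.edge w.edge) s (D.dual (σ.edge w.edge))),
      ∏ c : S.Corner p,
        D.d (σ'.edge c.sideIn.edge) *
          D.N (σ'.edge c.sideIn.edge) s (σ.edge c.sideIn.edge)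
            (D.dual (σ.edge c.sideOut.edge)) (σ.edge c.outer) (D.dual (σ'.edge c.sideOut.edge))
            (a c.sideIn) (σ.vert c.face) (σ'.vert c.face) (a c.sideOut)
  else 0

/-- The operator `B_p^s : H(Γ, Φ) → H(Γ, Φ')`, used for `Φ' = Φ + g.δp`, `s ∈ I_g`. -/
noncomputable def stringOp (p : V) (s : D.A) (Φ Φ' : S.Coloring G) :
    D.StateSpace Φ →ₗ[𝕜] D.StateSpace Φ' :=
  Matrix.mulVecLin (Matrix.of fun σ' σ => D.stringCoeff p s σ' σ)

/-- The operator `B_p^g : H(Γ, Φ) → H(Γ, Φ')`, used for `Φ' = Φ + g.δp`. -/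
noncomputable def gradedPlaquetteOp (p : V) (g : G) (Φ Φ' : S.Coloring G) :
    D.StateSpace Φ →ₗ[𝕜] D.StateSpace Φ' :=
  ∑ s ∈ D.I g, D.b s • D.stringOp p s Φ Φ'

/-- The values `g` for which `B_p^g B_p^{-g}` is defined on `H(Γ, Φ)`: `g` is generic and
`Φ - g.δp` is admissible. -/
def GenericAt (Φ : S.Coloring G) (p : V) (g : G) : Prop :=
  g ∉ D.X ∧ D.Admissible (Φ + S.plaquetteColoring (-g) p)

/-- The plaquette operator `B_p = B_p^g B_p^{-g}` on `H(Γ, Φ)`, computed with `g`. -/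
noncomputable def plaquetteOp (Φ : S.Coloring G) (p : V) (g : G) : Module.End 𝕜 (D.StateSpace Φ) :=
  D.gradedPlaquetteOp p g (Φ + S.plaquetteColoring (-g) p) Φ ∘ₗ
    D.gradedPlaquetteOp p (-g) Φ (Φ + S.plaquetteColoring (-g) p)

end LWData

/-! Think of `B_p^s` as inserting a loop labelled `s` in the plaquette `p` and fusing it into the
boundary. Everything rests on the fusion of two parallel loops: `B_p^{s₁} B_p^{s₂} = ∑ₛ δ(s₁, s₂,
s*) B_p^s` when `deg s₁ + deg s₂` is generic and the intermediate coloring is admissible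
(`loopCoeff_mul`, `stringOp_comp`). The matrix entries are transfer matrices around the boundary. At
each corner the pentagon replaces the sum over the intermediate vertex label by a sum over a fused
string. At each side orthogonality then removes the intermediate side label and forces the fused
strings at the two adjacent corners to agree. Since the link of `p` is connected, a single `s`
survives. Weighting by `b` gives `B_p^{g₁} B_p^{g₂} = B_p^{g₁+g₂}` (`gradedPlaquetteOp_comp`).

This law cannot be used with `g₁ + g₂ = 0`, which need not be generic. The way around is an
auxiliary degree `h` with `h - g` generic, available because finitely many translates of `X` do not
cover `G`. Then `B^g B^{-g} = B^g B^{h-g} B^{-h} = B^h B^{-h}` gives independence of the degree, and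
`B^{-g} B^h B^{-h} = B^{h-g} B^{-h} = B^{-g}` gives idempotence.

For distinct plaquettes the two loops interact only if the plaquettes are adjacent, and then only
along one side and its two end vertices. The local factor there (`edgeCoeff`) does not depend on the
order of the operators: the pentagon at either end trades the intermediate label of one order for
that of the other, with the same `6j` symbol as kernel (`edgeCoeff_swap`).

Hermiticity comes from the conjugation rule for `N`: up to the weights of the form, conjugating the
transfer matrix of `s*` gives the transposed one of `s` (`loopCoeff_star`), so `B_p^g` and
`B_p^{-g}` are adjoint. -/

set_option linter.unusedSectionVars false

/-! ### Genericity, plaquette boundaries and shifts of colorings -/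

namespace GradedLabels

variable {G : Type*} [AddCommGroup G] (L : GradedLabels G)

@[simp]
theorem mem_I {g : G} {a : L.A} : a ∈ L.I g ↔ L.deg a = g := by
  simp [I]

theorem neg_mem_X_iff {x : G} : -x ∈ L.X ↔ x ∈ L.X := by
  conv_rhs => rw [← L.X_symm]
  exact Set.mem_neg.symm

/-- Otherwise the finitely many translates `y + X` would cover `G`. -/
theorem exists_forall_sub_notMem {Y : Set G} (hY : Y.Finite) : ∃ g, ∀ y ∈ Y, g - y ∉ L.X := by
  by_contra! h
  refine L.X_small Y hY fun g _ => ?_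
  obtain ⟨y, hy, hg⟩ := h g
  exact ⟨y, hy, g - y, hg, by simp⟩

end GradedLabels

namespace TriangulatedSurface

variable {V : Type*} {S : TriangulatedSurface V}

/-- Together with `sideOut_bijective` this replaces the cyclic numbering of the sides: every side
enters exactly one corner and leaves exactly one. Products over corners can thus be rewritten as
products over sides in two ways. -/
theorem Corner.sideIn_bijective {p : V} :
    Function.Bijective (Corner.sideIn : S.Corner p → S.Side p) := by
  constructor
  · rintro ⟨⟨w, u⟩, h⟩ ⟨⟨w', u'⟩, h'⟩ heq
    obtain rfl : u = u' := congrArg Subtype.val heq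
    obtain rfl : w = w' := S.tri_unique (S.tri_rotate (S.tri_rotate h))
      (S.tri_rotate (S.tri_rotate h'))
    rfl
  · rintro ⟨u, c, h⟩
    exact ⟨⟨(c, u), S.tri_rotate h⟩, rfl⟩

theorem Corner.sideOut_bijective {p : V} :
    Function.Bijective (Corner.sideOut : S.Corner p → S.Side p) := by
  constructor
  · rintro ⟨⟨w, u⟩, h⟩ ⟨⟨w', u'⟩, h'⟩ heq
    obtain rfl : w = w' := congrArg Subtype.val heq
    obtain rfl : u = u' := S.tri_unique h h'
    rfl
  · rintro ⟨w, h⟩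
    obtain ⟨c, hc⟩ := S.tri_opposite h.choose_spec
    exact ⟨⟨(w, c), hc⟩, rfl⟩

theorem Side.nonempty (S : TriangulatedSurface V) (p : V) : Nonempty (S.Side p) := by
  obtain ⟨b, c, h⟩ := S.exists_tri p
  exact ⟨⟨c, _, S.tri_rotate (S.tri_rotate h)⟩⟩

/-- A function on the sides of a plaquette that does not change at the corners is constant. -/
theorem Side.const_of_corner {p : V} {T : Type*} {f : S.Side p → T}
    (hf : ∀ c : S.Corner p, f c.sideOut = f c.sideIn) (w w' : S.Side p) : f w = f w' := by
  obtain ⟨⟨⟨b, c⟩, h⟩, rfl⟩ := Corner.sideOut_bijective.2 w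
  obtain ⟨⟨⟨b', c'⟩, h'⟩, rfl⟩ := Corner.sideOut_bijective.2 w'
  -- A step `y → z` in the link of `p` is the corner `p, y, z`, with outgoing side `y` and incoming
  -- side `z`; connectedness of the link then reaches every side.
  have key : ∀ x, Relation.ReflTransGen (S.tri p) b x → ∀ hx : S.graph.Adj x p,
      f (Corner.sideOut ⟨(b, c), h⟩) = f ⟨x, hx⟩ := by
    intro x hx
    induction hx with
    | refl => exact fun _ => rfl
    | @tail y z _ hyz ih =>
      exact fun hz => (ih (S.tri_opposite hyz)).trans (hf ⟨(y, z), hyz⟩)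
  exact key b' (S.link_connected h h') _

variable [DecidableEq V]

theorem Flag.eq_or_rotate_of_face_eq {f f' : S.Flag} (h : f.face = f'.face) :
    f'.1 = f.1 ∨ f'.1 = (f.1.2.1, f.1.2.2, f.1.1) ∨ f'.1 = (f.1.2.2, f.1.1, f.1.2.1) := by
  obtain ⟨⟨a, b, c⟩, hf⟩ := f
  obtain ⟨⟨a', b', c'⟩, hf'⟩ := f'
  have h₁' : a' ≠ b' := S.tri_ne hf'
  have h₂' : b' ≠ c' := S.tri_ne (S.tri_rotate hf')
  have h₃' : c' ≠ a' := S.tri_ne (S.tri_rotate (S.tri_rotate hf'))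
  have hset : ({a, b, c} : Finset V) = {a', b', c'} := congrArg Subtype.val h
  have ha : a' ∈ ({a, b, c} : Finset V) := by rw [hset]; simp
  have hb : b' ∈ ({a, b, c} : Finset V) := by rw [hset]; simp
  have hc : c' ∈ ({a, b, c} : Finset V) := by rw [hset]; simp
  simp only [Finset.mem_insert, Finset.mem_singleton] at ha hb hc
  rcases ha with rfl | rfl | rfl <;> rcases hb with rfl | rfl | rfl <;>
    rcases hc with rfl | rfl | rfl <;>
    first
    | exact absurd rfl h₁'
    | exact absurd rfl h₂'
    | exact absurd rfl h₃'
    | (simp; done)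
    | exact absurd (S.tri_rotate hf') (S.tri_not_swap hf)
    | exact absurd (S.tri_rotate (S.tri_rotate hf')) (S.tri_not_swap hf)
    | exact absurd hf' (S.tri_not_swap hf)

theorem Corner.mem_face {p : V} (c : S.Corner p) : p ∈ c.face.1 := by
  simp [Corner.face, Flag.face]

theorem Corner.face_injective {p : V} : Function.Injective fun c : S.Corner p => c.face := by
  rintro ⟨⟨w, u⟩, h⟩ ⟨⟨w', u'⟩, h'⟩ heq
  have h₁ : p ≠ w := S.tri_ne h
  have h₃ : u ≠ p := S.tri_ne (S.tri_rotate (S.tri_rotate h))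
  rcases Flag.eq_or_rotate_of_face_eq heq with e | e | e <;>
    simp only [Prod.mk.injEq] at e
  · obtain ⟨-, rfl, rfl⟩ := e
    rfl
  · exact absurd e.1 h₁
  · exact absurd e.1.symm h₃

theorem Flag.exists_corner {p : V} {f : S.Flag} (h : p ∈ f.face.1) :
    ∃ c : S.Corner p, c.face = f.face := by
  obtain ⟨⟨x, y, z⟩, hf⟩ := f
  simp only [Flag.face, Finset.mem_insert, Finset.mem_singleton] at h
  rcases h with rfl | rfl | rfl
  · exact ⟨⟨(y, z), hf⟩, rfl⟩
  · refine ⟨⟨(z, x), S.tri_rotate hf⟩, Subtype.ext ?_⟩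
    ext t
    simp only [Corner.face, Flag.face, Finset.mem_insert, Finset.mem_singleton]
    tauto
  · refine ⟨⟨(x, y), S.tri_rotate (S.tri_rotate hf)⟩, Subtype.ext ?_⟩
    ext t
    simp only [Corner.face, Flag.face, Finset.mem_insert, Finset.mem_singleton]
    tauto

theorem Face.exists_flag (t : S.Face) : ∃ f : S.Flag, f.face = t := by
  obtain ⟨t, f, rfl⟩ := t
  exact ⟨f, rfl⟩

theorem Face.rep_face (t : S.Face) : t.rep.face = t := Subtype.ext t.2.choose_spec

theorem Face.exists_corner {p : V} {t : S.Face} (h : p ∈ t.1) :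
    ∃ c : S.Corner p, c.face = t := by
  obtain ⟨f, rfl⟩ := t.exists_flag
  exact Flag.exists_corner h

/-- The coloring `Φ + g.δp`, as a relation. -/
def IsShift {G : Type*} [AddCommGroup G] (p : V) (g : G) (Φ Φ' : S.Coloring G) : Prop :=
  ∀ e, Φ'.val e = Φ.val e + (S.plaquetteColoring g p).val e

section Shift

variable {G : Type*} [AddCommGroup G] {p : V} {g g' : G} {Φ Φ' Φ'' : S.Coloring G}

theorem isShift_add : IsShift p g Φ (Φ + S.plaquetteColoring g p) := fun _ => rfl

theorem plaquetteColoring_val_neg (e : S.OEdge) :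
    (S.plaquetteColoring (-g) p).val e = -(S.plaquetteColoring g p).val e := by
  simp only [plaquetteColoring]
  split_ifs <;> simp

theorem plaquetteColoring_val_add (e : S.OEdge) :
    (S.plaquetteColoring (g + g') p).val e =
      (S.plaquetteColoring g p).val e + (S.plaquetteColoring g' p).val e := by
  simp only [plaquetteColoring]
  split_ifs <;> simp [add_comm]

theorem IsShift.symm (h : IsShift p g Φ Φ') : IsShift p (-g) Φ' Φ := fun e => by
  rw [h e, plaquetteColoring_val_neg]; abel

theorem isShift_neg : IsShift p g (Φ + S.plaquetteColoring (-g) p) Φ := by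
  simpa using (isShift_add (Φ := Φ) (p := p) (g := -g)).symm

theorem IsShift.trans (h : IsShift p g Φ Φ') (h' : IsShift p g' Φ' Φ'') :
    IsShift p (g + g') Φ Φ'' := fun e => by
  rw [h' e, h e, plaquetteColoring_val_add]; abel

theorem IsShift.val_side (h : IsShift p g Φ Φ') (w : S.Side p) :
    Φ'.val w.edge = Φ.val w.edge - g := by
  have : w.1 ≠ p := w.2.ne
  rw [h]
  simp [plaquetteColoring, Side.edge, this, sub_eq_add_neg]

theorem IsShift.val_of_ne (h : IsShift p g Φ Φ') {e : S.OEdge} (h₁ : e.fst ≠ p) (h₂ : e.snd ≠ p) :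
    Φ'.val e = Φ.val e := by
  rw [h]
  simp [plaquetteColoring, h₁, h₂]

end Shift

end TriangulatedSurface

/-! ### Generic shifts, and sums over states with prescribed labels -/

namespace LWData

open TriangulatedSurface

variable {𝕜 : Type*} [Field 𝕜] [StarRing 𝕜] {G : Type*} [AddCommGroup G] (D : LWData 𝕜 G)
  {V : Type*} [DecidableEq V] {S : TriangulatedSurface V}

theorem exists_genericAt [Fintype V] {Φ Ψ : S.Coloring G} (hΦ : D.Admissible Φ)
    (hΨ : D.Admissible Ψ) (p : V) {Y : Set G} (hY : Y.Finite) :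
    ∃ g, D.GenericAt Φ p g ∧ D.GenericAt Ψ p g ∧ ∀ y ∈ Y, g - y ∉ D.X := by
  have hfin : ∀ Θ : S.Coloring G,
      (Set.range (fun e => Θ.val e) ∪ Set.range (fun e => -Θ.val e)).Finite := fun Θ =>
    (Set.finite_range _).union (Set.finite_range _)
  -- Avoiding the translate by `0` makes `g` itself generic. Avoiding those by `±Φ(e)` and `±Ψ(e)`
  -- makes the shifted colorings admissible, by the symmetry of `X`.
  obtain ⟨g, hg⟩ := D.exists_forall_sub_notMem
    (((hY.union (Set.finite_singleton 0)).union (hfin Φ)).union (hfin Ψ))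
  have hg0 : g ∉ D.X := by
    simpa using hg 0 (by simp)
  have key : ∀ Θ : S.Coloring G, D.Admissible Θ → (∀ e, g - Θ.val e ∉ D.X) →
      (∀ e, g - -Θ.val e ∉ D.X) → D.GenericAt Θ p g := by
    refine fun Θ hΘ h₁ h₂ => ⟨hg0, fun e => ?_⟩
    have he : (Θ + S.plaquetteColoring (-g) p).val e =
      Θ.val e + (S.plaquetteColoring (-g) p).val e := rfl
    rw [he]
    simp only [plaquetteColoring]
    split_ifs
    · rw [← D.neg_mem_X_iff]
      convert h₁ e using 2
      abel
    · convert h₂ e using 2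
      abel
    · simpa using hΘ e
  refine ⟨g, key Φ hΦ (fun e => hg _ ?_) (fun e => hg _ ?_), key Ψ hΨ (fun e => hg _ ?_)
    (fun e => hg _ ?_), fun y hy => hg y ?_⟩ <;> simp [*]

theorem δ_eq_of_face_eq {E : S.OEdge → D.A} {f f' : S.Flag} (h : f.face = f'.face) :
    D.δ (E f.e₁) (E f.e₂) (E f.e₃) = D.δ (E f'.e₁) (E f'.e₂) (E f'.e₃) := by
  have hr := Flag.eq_or_rotate_of_face_eq h
  obtain ⟨⟨a, b, c⟩, hf⟩ := f
  obtain ⟨⟨a', b', c'⟩, hf'⟩ := f'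
  simp only [Prod.mk.injEq] at hr
  rcases hr with ⟨rfl, rfl, rfl⟩ | ⟨rfl, rfl, rfl⟩ | ⟨rfl, rfl, rfl⟩
  · rfl
  · exact D.δ_rotate _ _ _
  · exact (D.δ_rotate _ _ _).symm

section Patch

variable {ι κ : Type*} (ed : ι → S.OEdge) (fl : κ → S.Flag)

/-- Relabel the edges `ed i`, and their opposites, by `j i`. -/
noncomputable def patchEdge (E : S.OEdge → D.A) (j : ι → D.A) : S.OEdge → D.A :=
  Function.extend ed j (Function.extend (fun i => (ed i).symm) (fun i => D.dual (j i)) E)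

/-- Relabel the triangles of the flags `fl k` by `C k`. -/
noncomputable def patchVert (U : S.Face → ℕ) (C : κ → ℕ) : S.Face → ℕ :=
  Function.extend (fun k => (fl k).face) C U

variable {ed fl}

theorem patchEdge_apply (hed : Function.Injective ed) (E : S.OEdge → D.A) (j : ι → D.A) (i : ι) :
    D.patchEdge ed E j (ed i) = j i :=
  hed.extend_apply _ _ _

theorem patchEdge_symm (hed : Function.Injective ed) (hsep : ∀ i i', ed i ≠ (ed i').symm)
    (E : S.OEdge → D.A) (j : ι → D.A) (i : ι) :
    D.patchEdge ed E j (ed i).symm = D.dual (j i) := by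
  rw [patchEdge, Function.extend_apply' _ _ _ (fun ⟨i', h⟩ => hsep _ _ h)]
  have : Function.Injective fun i => (ed i).symm := fun a b h =>
    hed (by simpa using congrArg SimpleGraph.Dart.symm h)
  exact this.extend_apply _ _ _

theorem patchEdge_of_ne (E : S.OEdge → D.A) (j : ι → D.A) {e : S.OEdge}
    (h : ∀ i, ed i ≠ e) (h' : ∀ i, (ed i).symm ≠ e) : D.patchEdge ed E j e = E e := by
  rw [patchEdge, Function.extend_apply' _ _ _ (fun ⟨i, hi⟩ => h i hi),
    Function.extend_apply' _ _ _ (fun ⟨i, hi⟩ => h' i hi)]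

theorem patchVert_apply (hfl : Function.Injective fun k => (fl k).face) (U : S.Face → ℕ)
    (C : κ → ℕ) (k : κ) : patchVert fl U C (fl k).face = C k :=
  hfl.extend_apply _ _ _

theorem patchVert_of_ne (U : S.Face → ℕ) (C : κ → ℕ) {t : S.Face} (h : ∀ k, (fl k).face ≠ t) :
    patchVert fl U C t = U t :=
  Function.extend_apply' _ _ _ (fun ⟨k, hk⟩ => h k hk)

open Finset in
/-- A sum over the states which agree with given labels off the edges `ed i` and the triangles of
the flags `fl k` is a sum over the labels of these edges and triangles. -/
theorem sum_state_eq [Fintype V] [Fintype ι] [DecidableEq ι] [Fintype κ] [DecidableEq κ]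
    {Φ : S.Coloring G}
    (hed : Function.Injective ed) (hsep : ∀ i i', ed i ≠ (ed i').symm)
    (hfl : Function.Injective fun k => (fl k).face)
    {E : S.OEdge → D.A} {U : S.Face → ℕ}
    (hdeg : ∀ e, (∀ i, ed i ≠ e) → (∀ i, (ed i).symm ≠ e) → D.deg (E e) = Φ.val e)
    (hsymm : ∀ e, (∀ i, ed i ≠ e) → (∀ i, (ed i).symm ≠ e) → E e.symm = D.dual (E e))
    (hU : ∀ f : S.Flag, (∀ k, (fl k).face ≠ f.face) →
      U f.face ≤ D.δ (E f.e₁) (E f.e₂) (E f.e₃) ∧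
        ∀ e, e = f.e₁ ∨ e = f.e₂ ∨ e = f.e₃ → (∀ i, ed i ≠ e) ∧ (∀ i, (ed i).symm ≠ e))
    (F : (S.OEdge → D.A) → (S.Face → ℕ) → 𝕜)
    (hF : ∀ σ : D.State Φ, F σ.edge σ.vert ≠ 0 →
      (∀ e, (∀ i, ed i ≠ e) → (∀ i, (ed i).symm ≠ e) → σ.edge e = E e) ∧
      (∀ t, (∀ k, (fl k).face ≠ t) → σ.vert t = U t) ∧ ∀ k, σ.vert (fl k).face ≠ 0) :
    ∑ σ : D.State Φ, F σ.edge σ.vert =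
      ∑ j ∈ Fintype.piFinset fun i => D.I (Φ.val (ed i)),
        ∑ C ∈ Fintype.piFinset fun k => Icc 1 (D.δ (D.patchEdge ed E j (fl k).e₁)
          (D.patchEdge ed E j (fl k).e₂) (D.patchEdge ed E j (fl k).e₃)),
          F (D.patchEdge ed E j) (patchVert fl U C) := by
  classical
  rw [Finset.sum_sigma']
  have hpatch : ∀ σ : D.State Φ, F σ.edge σ.vert ≠ 0 →
      D.patchEdge ed E (fun i => σ.edge (ed i)) = σ.edge ∧
      patchVert fl U (fun k => σ.vert (fl k).face) = σ.vert := by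
    intro σ hσ
    obtain ⟨h₁, h₂, -⟩ := hF σ hσ
    constructor
    · funext e
      by_cases he : ∃ i, ed i = e
      · obtain ⟨i, rfl⟩ := he
        rw [D.patchEdge_apply hed]
      by_cases he' : ∃ i, (ed i).symm = e
      · obtain ⟨i, rfl⟩ := he'
        rw [D.patchEdge_symm hed hsep, σ.edge_symm]
      push Not at he he'
      rw [D.patchEdge_of_ne _ _ he he', h₁ e he he']
    · funext t
      by_cases ht : ∃ k, (fl k).face = t
      · obtain ⟨k, rfl⟩ := ht
        rw [patchVert_apply hfl]
      push Not at ht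
      rw [patchVert_of_ne _ _ ht, h₂ t ht]
  -- Only on the support of `F` is a state determined by its labels on the patch, so injectivity is
  -- available only after this restriction.
  rw [← Finset.sum_filter_ne_zero]
  refine Finset.sum_of_injOn
    (fun σ => ⟨fun i => σ.edge (ed i), fun k => σ.vert (fl k).face⟩) ?_ ?_ ?_ ?_
  · intro σ hσ τ hτ h
    simp only [coe_filter, mem_univ, true_and, Set.mem_ofPred_eq] at hσ hτ
    simp only [Sigma.mk.injEq, heq_eq_eq] at h
    have h₁ := hpatch σ hσ
    have h₂ := hpatch τ hτ
    rw [h.1, h.2] at h₁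
    exact State.ext (h₁.1.symm.trans h₂.1) (h₁.2.symm.trans h₂.2)
  · intro σ hσ
    simp only [coe_filter, mem_univ, true_and, Set.mem_ofPred_eq] at hσ
    simp only [coe_sigma, Set.mem_sigma_iff, mem_coe, Fintype.mem_piFinset, GradedLabels.mem_I,
      mem_Icc, (hpatch σ hσ).1]
    exact ⟨fun i => σ.deg_edge _, fun k =>
      ⟨Nat.one_le_iff_ne_zero.mpr ((hF σ hσ).2.2 k), σ.vert_le _⟩⟩
  · rintro ⟨j, C⟩ hjC hnot
    simp only [mem_sigma, Fintype.mem_piFinset, GradedLabels.mem_I, mem_Icc] at hjC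
    obtain ⟨hj, hC⟩ := hjC
    by_contra hne
    refine hnot ?_
    -- Any admissible choice of patch labels extends, with the prescribed labels elsewhere, to a
    -- genuine state.
    refine ⟨⟨D.patchEdge ed E j, patchVert fl U C, fun e => ?_, fun e => ?_, fun f => ?_⟩, ?_, ?_⟩
    · by_cases he : ∃ i, ed i = e
      · obtain ⟨i, rfl⟩ := he
        rw [D.patchEdge_apply hed, hj]
      by_cases he' : ∃ i, (ed i).symm = e
      · obtain ⟨i, rfl⟩ := he'
        rw [D.patchEdge_symm hed hsep, D.deg_dual, hj, Φ.val_symm]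
      push Not at he he'
      rw [D.patchEdge_of_ne _ _ he he', hdeg e he he']
    · by_cases he : ∃ i, ed i = e
      · obtain ⟨i, rfl⟩ := he
        rw [D.patchEdge_apply hed, D.patchEdge_symm hed hsep]
      by_cases he' : ∃ i, (ed i).symm = e
      · obtain ⟨i, rfl⟩ := he'
        rw [D.patchEdge_symm hed hsep, D.dual_dual, SimpleGraph.Dart.symm_symm,
          D.patchEdge_apply hed]
      push Not at he he'
      rw [D.patchEdge_of_ne _ _ he he', D.patchEdge_of_ne, hsymm e he he']
      · exact fun i h => he' i (by rw [h, SimpleGraph.Dart.symm_symm])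
      · exact fun i h => he i (by simpa using congrArg SimpleGraph.Dart.symm h)
    · by_cases hf : ∃ k, (fl k).face = f.face
      · obtain ⟨k, hk⟩ := hf
        rw [← hk, patchVert_apply hfl, ← D.δ_eq_of_face_eq hk]
        exact (hC k).2
      push Not at hf
      obtain ⟨h₁, h₂⟩ := hU f hf
      rw [patchVert_of_ne _ _ hf,
        D.patchEdge_of_ne _ _ (h₂ _ (Or.inl rfl)).1 (h₂ _ (Or.inl rfl)).2,
        D.patchEdge_of_ne _ _ (h₂ _ (Or.inr (Or.inl rfl))).1 (h₂ _ (Or.inr (Or.inl rfl))).2,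
        D.patchEdge_of_ne _ _ (h₂ _ (Or.inr (Or.inr rfl))).1 (h₂ _ (Or.inr (Or.inr rfl))).2]
      exact h₁
    · simpa using hne
    · simp only [Sigma.mk.injEq, heq_eq_eq]
      exact ⟨funext fun i => D.patchEdge_apply hed _ _ _,
        funext fun k => patchVert_apply hfl _ _ _⟩
  · intro σ hσ
    simp only [mem_filter, mem_univ, true_and] at hσ
    rw [(hpatch σ hσ).1, (hpatch σ hσ).2]

end Patch

end LWData

/-! ### Fusion of two parallel strings around a loop -/

section PiFinset

open Finset

variable {W α β R : Type*} [Fintype W] [DecidableEq W] [AddCommMonoid R]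

/-- Collecting all labels of one side into a single pair brings the sum to the form in which
`Finset.prod_univ_sum` exchanges sums with products. -/
theorem sum_piFinset_sigma (J : W → Finset α) (Q : W → α → Finset β) (F : (W → α) → (W → β) → R) :
    ∑ j ∈ Fintype.piFinset J, ∑ b ∈ Fintype.piFinset fun w => Q w (j w), F j b =
      ∑ y ∈ Fintype.piFinset fun w => (J w).sigma (Q w),
        F (fun w => (y w).1) (fun w => (y w).2) := by
  rw [Finset.sum_sigma']
  refine Finset.sum_nbij' (fun x w => ⟨x.1 w, x.2 w⟩) (fun y => ⟨fun w => (y w).1, fun w => (y w).2⟩)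
    ?_ ?_ ?_ ?_ ?_
  · intro x hx
    simp only [mem_sigma, Fintype.mem_piFinset] at hx ⊢
    exact fun w => ⟨hx.1 w, hx.2 w⟩
  · intro x hx
    simp only [mem_sigma, Fintype.mem_piFinset] at hx ⊢
    exact ⟨fun w => (hx w).1, fun w => (hx w).2⟩
  all_goals intros; rfl

theorem sum_piFinset_product (J : W → Finset α) (Q : W → Finset β) (F : (W → α) → (W → β) → R) :
    ∑ j ∈ Fintype.piFinset J, ∑ b ∈ Fintype.piFinset Q, F j b =
      ∑ y ∈ Fintype.piFinset fun w => J w ×ˢ Q w, F (fun w => (y w).1) (fun w => (y w).2) := by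
  rw [← Finset.sum_product']
  refine Finset.sum_nbij' (fun x w => ⟨x.1 w, x.2 w⟩) (fun y => ⟨fun w => (y w).1, fun w => (y w).2⟩)
    ?_ ?_ ?_ ?_ ?_
  · intro x hx
    simp only [mem_product, Fintype.mem_piFinset] at hx ⊢
    exact fun w => ⟨hx.1 w, hx.2 w⟩
  · intro x hx
    simp only [mem_product, Fintype.mem_piFinset] at hx ⊢
    exact ⟨fun w => (hx w).1, fun w => (hx w).2⟩
  all_goals intros; rfl

end PiFinset

namespace LWData

open Finset

variable {𝕜 : Type*} [Field 𝕜] [StarRing 𝕜] {G : Type*} [AddCommGroup G] (D : LWData 𝕜 G)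

theorem sum_I_dual {M : Type*} [AddCommMonoid M] (g : G) (f : D.A → M) :
    ∑ n ∈ D.I g, f n = ∑ j ∈ D.I (-g), f (D.dual j) := by
  refine Finset.sum_nbij' D.dual D.dual ?_ ?_ ?_ ?_ ?_ <;>
    simp +contextual [D.deg_dual, D.dual_dual]

open Classical in
/-- Orthogonality, in the form used at a side of a plaquette. -/
theorem sum_side (s₁ s₂ s S j j'' : D.A) {c₂ c₃ c₁' c₂' : ℕ} (hX : D.deg j - D.deg s₂ ∉ D.X)
    (h₂ : 1 ≤ c₂ ∧ c₂ ≤ D.δ s₁ s₂ (D.dual s))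
    (h₃ : 1 ≤ c₃ ∧ c₃ ≤ D.δ s (D.dual j) (D.dual (D.dual j''))) :
    ∑ j' ∈ D.I (D.deg j - D.deg s₂), ∑ A ∈ Icc 1 (D.δ j'' s₁ (D.dual j')),
      ∑ B ∈ Icc 1 (D.δ j' s₂ (D.dual j)),
        D.d j' * D.N s₁ s₂ s (D.dual j) (D.dual j'') (D.dual j') c₂ c₃ A B *
          D.N j'' s₁ j' s₂ j S A B c₁' c₂' =
      if S = s ∧ c₂ = c₂' ∧ c₃ = c₁' then 1 / D.d S else 0 := by
  -- The label summed in `orthogonality` is the dual of the side label `j'`, hence the opposite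
  -- degree and the reindexing by `dual`.
  have hdeg : D.deg s₂ + D.deg (D.dual j) = -(D.deg j - D.deg s₂) := by
    rw [D.deg_dual]; abel
  rw [← D.orthogonality s₁ s₂ S (D.dual j) (D.dual j'') s c₂ c₃ c₂' c₁'
    (by rwa [hdeg, D.neg_mem_X_iff]) h₂ h₃, hdeg,
    D.sum_I_dual (-_), neg_neg]
  refine Finset.sum_congr rfl fun j' _ => ?_
  have e₁ : D.δ j'' s₁ (D.dual j') = D.δ s₁ (D.dual j') (D.dual (D.dual j'')) := by
    rw [D.δ_rotate, D.dual_dual]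
  have e₂ : D.δ j' s₂ (D.dual j) = D.δ s₂ (D.dual j) (D.dual (D.dual j')) := by
    rw [D.δ_rotate, D.dual_dual]
  rw [e₁, e₂]
  refine Finset.sum_congr rfl fun A _ => Finset.sum_congr rfl fun B _ => ?_
  rw [D.d_dual, D.N_symm₂ S, D.N_symm₁ s₁ (D.dual j'), D.N_symm₁ (D.dual j')]
  simp only [D.dual_dual]

/-- A transfer matrix around a loop with sides `W` and corners `K`, the corner `k` lying between
the sides `inn k` and `out k`. -/
noncomputable def loopCoeff {W K : Type*} [Fintype W] [DecidableEq W] [Fintype K]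
    (inn out : K → W) (outer : K → D.A) (s : D.A) (j' j : W → D.A) (C' C : K → ℕ) : 𝕜 :=
  ∑ a ∈ Fintype.piFinset fun w => Icc 1 (D.δ (j' w) s (D.dual (j w))),
    ∏ k, D.d (j' (inn k)) *
      D.N (j' (inn k)) s (j (inn k)) (D.dual (j (out k))) (outer k) (D.dual (j' (out k)))
        (a (inn k)) (C k) (C' k) (a (out k))

section Loop

variable {W K : Type*} [Fintype W] [DecidableEq W] [Fintype K] [DecidableEq K]
  (inn out : K ≃ W) (outer : K → D.A) (s₁ s₂ : D.A) (j₂ j₀ : W → D.A) (C₂ C₀ : K → ℕ)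

/-- All labels of a side (its intermediate label and the two string vertices on it) are gathered in
`y`. Each intermediate vertex label then occurs at one corner only, so its sum moves inside the
product and becomes the two-symbol side of the pentagon. -/
theorem loopCoeff_mul_expand :
    ∑ j ∈ Fintype.piFinset fun w => D.I (D.deg (j₀ w) - D.deg s₂),
      ∑ C ∈ Fintype.piFinset fun k =>
          Icc 1 (D.δ (D.dual (j (out k))) (D.dual (outer k)) (j (inn k))),
        D.loopCoeff inn out outer s₁ j₂ j C₂ C * D.loopCoeff inn out outer s₂ j j₀ C C₀ =
    ∑ y ∈ Fintype.piFinset fun w => (D.I (D.deg (j₀ w) - D.deg s₂)).sigma fun j =>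
        Icc 1 (D.δ (j₂ w) s₁ (D.dual j)) ×ˢ Icc 1 (D.δ j s₂ (D.dual (j₀ w))),
      ∏ k, D.d (j₂ (inn k)) * D.d (y (inn k)).1 *
        ∑ C ∈ Icc 1 (D.δ (y (inn k)).1 (D.dual (y (out k)).1) (D.dual (outer k))),
          D.N (y (inn k)).1 s₂ (j₀ (inn k)) (D.dual (j₀ (out k))) (outer k)
              (D.dual (y (out k)).1) (y (inn k)).2.2 (C₀ k) C (y (out k)).2.2 *
            D.N (j₂ (inn k)) s₁ (y (inn k)).1 (D.dual (y (out k)).1) (outer k)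
              (D.dual (j₂ (out k))) (y (inn k)).2.1 C (C₂ k) (y (out k)).2.1 := by
  rw [← sum_piFinset_sigma (fun w => D.I (D.deg (j₀ w) - D.deg s₂))
    (fun w j => Icc 1 (D.δ (j₂ w) s₁ (D.dual j)) ×ˢ Icc 1 (D.δ j s₂ (D.dual (j₀ w))))
    (fun j b => ∏ k, D.d (j₂ (inn k)) * D.d (j (inn k)) *
        ∑ C ∈ Icc 1 (D.δ (j (inn k)) (D.dual (j (out k))) (D.dual (outer k))),
          D.N (j (inn k)) s₂ (j₀ (inn k)) (D.dual (j₀ (out k))) (outer k)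
              (D.dual (j (out k))) (b (inn k)).2 (C₀ k) C (b (out k)).2 *
            D.N (j₂ (inn k)) s₁ (j (inn k)) (D.dual (j (out k))) (outer k)
              (D.dual (j₂ (out k))) (b (inn k)).1 C (C₂ k) (b (out k)).1)]
  refine Finset.sum_congr rfl fun j _ => ?_
  rw [← sum_piFinset_product (fun w => Icc 1 (D.δ (j₂ w) s₁ (D.dual (j w))))
    (fun w => Icc 1 (D.δ (j w) s₂ (D.dual (j₀ w))))
    (fun A B => ∏ k, D.d (j₂ (inn k)) * D.d (j (inn k)) *
        ∑ C ∈ Icc 1 (D.δ (j (inn k)) (D.dual (j (out k))) (D.dual (outer k))),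
          D.N (j (inn k)) s₂ (j₀ (inn k)) (D.dual (j₀ (out k))) (outer k)
              (D.dual (j (out k))) (B (inn k)) (C₀ k) C (B (out k)) *
            D.N (j₂ (inn k)) s₁ (j (inn k)) (D.dual (j (out k))) (outer k)
              (D.dual (j₂ (out k))) (A (inn k)) C (C₂ k) (A (out k)))]
  have hδ : ∀ k, D.δ (D.dual (j (out k))) (D.dual (outer k)) (j (inn k)) =
      D.δ (j (inn k)) (D.dual (j (out k))) (D.dual (outer k)) := fun k => (D.δ_rotate _ _ _).symm
  simp only [hδ, loopCoeff, Finset.sum_mul_sum]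
  rw [Finset.sum_comm]
  refine Finset.sum_congr rfl fun A _ => ?_
  rw [Finset.sum_comm]
  refine Finset.sum_congr rfl fun B _ => ?_
  -- With the side labels fixed, the vertex labels at different corners vary independently.
  rw [Finset.prod_mul_distrib, Finset.prod_univ_sum, Finset.mul_sum]
  refine Finset.sum_congr rfl fun C _ => ?_
  rw [← Finset.prod_mul_distrib, ← Finset.prod_mul_distrib]
  exact Finset.prod_congr rfl fun k _ => by ring

-- The pentagon puts at each corner a fused string `(z k).1`, with a fusion label `(z k).2.2.1` and
-- labels `(z k).2.1`, `(z k).2.2.2` where it meets the incoming and the outgoing side. Of its three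
-- symbols one is the corner factor of the fused string; the other two involve one side each, and
-- orthogonality there identifies the data of neighbouring corners.
open Classical in
theorem loopCoeff_mul_transfer (hX : D.deg s₁ + D.deg s₂ ∉ D.X)
    (hX' : ∀ w, D.deg (j₀ w) - D.deg s₂ ∉ D.X) :
    ∑ j ∈ Fintype.piFinset fun w => D.I (D.deg (j₀ w) - D.deg s₂),
      ∑ C ∈ Fintype.piFinset fun k =>
          Icc 1 (D.δ (D.dual (j (out k))) (D.dual (outer k)) (j (inn k))),
        D.loopCoeff inn out outer s₁ j₂ j C₂ C * D.loopCoeff inn out outer s₂ j j₀ C C₀ =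
    ∑ z ∈ Fintype.piFinset fun k => (D.I (D.deg s₁ + D.deg s₂)).sigma fun s =>
        Icc 1 (D.δ (j₂ (inn k)) s (D.dual (j₀ (inn k)))) ×ˢ Icc 1 (D.δ s₁ s₂ (D.dual s)) ×ˢ
          Icc 1 (D.δ s (D.dual (j₀ (out k))) (D.dual (D.dual (j₂ (out k))))),
      (if ∀ w, (z (inn.symm w)).1 = (z (out.symm w)).1 ∧
          (z (out.symm w)).2.2.1 = (z (inn.symm w)).2.2.1 ∧
          (z (out.symm w)).2.2.2 = (z (inn.symm w)).2.1 then
        ∏ k, D.d (j₂ (inn k)) *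
          D.N (j₂ (inn k)) (z k).1 (j₀ (inn k)) (D.dual (j₀ (out k))) (outer k)
            (D.dual (j₂ (out k))) (z k).2.1 (C₀ k) (C₂ k) (z k).2.2.2 else 0) := by
  rw [loopCoeff_mul_expand]
  have hpent : ∀ (y : W → Σ _ : D.A, ℕ × ℕ) (k : K),
      D.d (j₂ (inn k)) * D.d (y (inn k)).1 *
        ∑ C ∈ Icc 1 (D.δ (y (inn k)).1 (D.dual (y (out k)).1) (D.dual (outer k))),
          D.N (y (inn k)).1 s₂ (j₀ (inn k)) (D.dual (j₀ (out k))) (outer k)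
              (D.dual (y (out k)).1) (y (inn k)).2.2 (C₀ k) C (y (out k)).2.2 *
            D.N (j₂ (inn k)) s₁ (y (inn k)).1 (D.dual (y (out k)).1) (outer k)
              (D.dual (j₂ (out k))) (y (inn k)).2.1 C (C₂ k) (y (out k)).2.1 =
      ∑ z ∈ (D.I (D.deg s₁ + D.deg s₂)).sigma fun s =>
        Icc 1 (D.δ (j₂ (inn k)) s (D.dual (j₀ (inn k)))) ×ˢ Icc 1 (D.δ s₁ s₂ (D.dual s)) ×ˢ
          Icc 1 (D.δ s (D.dual (j₀ (out k))) (D.dual (D.dual (j₂ (out k))))),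
        (D.d z.1 * (D.d (j₂ (inn k)) *
          D.N (j₂ (inn k)) z.1 (j₀ (inn k)) (D.dual (j₀ (out k))) (outer k)
            (D.dual (j₂ (out k))) z.2.1 (C₀ k) (C₂ k) z.2.2.2)) *
        ((D.d (y (inn k)).1 * D.N (j₂ (inn k)) s₁ (y (inn k)).1 s₂ (j₀ (inn k)) z.1
          (y (inn k)).2.1 (y (inn k)).2.2 z.2.1 z.2.2.1) *
         D.N s₁ s₂ z.1 (D.dual (j₀ (out k))) (D.dual (j₂ (out k))) (D.dual (y (out k)).1)
          z.2.2.1 z.2.2.2 (y (out k)).2.1 (y (out k)).2.2) := by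
    intro y k
    rw [← D.pentagon _ _ _ _ _ _ _ _ _ _ _ _ _ _ _ hX, Finset.sum_sigma, Finset.mul_sum]
    refine Finset.sum_congr rfl fun s _ => ?_
    rw [Finset.sum_product, Finset.mul_sum]
    refine Finset.sum_congr rfl fun c₁ _ => ?_
    rw [Finset.sum_product, Finset.mul_sum]
    refine Finset.sum_congr rfl fun c₂ _ => ?_
    rw [Finset.mul_sum]
    exact Finset.sum_congr rfl fun c₃ _ => by ring
  simp only [hpent]
  simp only [Finset.prod_univ_sum]
  rw [Finset.sum_comm]
  refine Finset.sum_congr rfl fun z hz => ?_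
  simp only [Finset.prod_mul_distrib]
  rw [← Finset.mul_sum]
  -- Regrouping by sides: a side receives one symbol from the corner it enters and one from the
  -- corner it leaves.
  have hre : ∀ y : W → Σ _ : D.A, ℕ × ℕ,
      ((∏ k, D.d (y (inn k)).1) *
        ∏ k, D.N (j₂ (inn k)) s₁ (y (inn k)).1 s₂ (j₀ (inn k)) (z k).1
          (y (inn k)).2.1 (y (inn k)).2.2 (z k).2.1 (z k).2.2.1) *
         ∏ k, D.N s₁ s₂ (z k).1 (D.dual (j₀ (out k))) (D.dual (j₂ (out k)))
          (D.dual (y (out k)).1) (z k).2.2.1 (z k).2.2.2 (y (out k)).2.1 (y (out k)).2.2 =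
      ∏ w, D.d (y w).1 *
        D.N s₁ s₂ (z (out.symm w)).1 (D.dual (j₀ w)) (D.dual (j₂ w)) (D.dual (y w).1)
          (z (out.symm w)).2.2.1 (z (out.symm w)).2.2.2 (y w).2.1 (y w).2.2 *
        D.N (j₂ w) s₁ (y w).1 s₂ (j₀ w) (z (inn.symm w)).1
          (y w).2.1 (y w).2.2 (z (inn.symm w)).2.1 (z (inn.symm w)).2.2.1 := by
    intro y
    rw [Finset.prod_mul_distrib, Finset.prod_mul_distrib, mul_right_comm]
    congr 1
    · congr 1
      · exact inn.prod_comp fun w => D.d (y w).1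
      · rw [← out.prod_comp]
        simp only [Equiv.symm_apply_apply]
    · rw [← inn.prod_comp]
      simp only [Equiv.symm_apply_apply]
  simp only [hre]
  -- The sum over `y` factors over the sides, and `sum_side` evaluates each factor.
  rw [← Finset.prod_univ_sum (fun w => (D.I (D.deg (j₀ w) - D.deg s₂)).sigma fun j =>
        Icc 1 (D.δ (j₂ w) s₁ (D.dual j)) ×ˢ Icc 1 (D.δ j s₂ (D.dual (j₀ w))))
      (fun w y => D.d y.1 *
        D.N s₁ s₂ (z (out.symm w)).1 (D.dual (j₀ w)) (D.dual (j₂ w)) (D.dual y.1)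
          (z (out.symm w)).2.2.1 (z (out.symm w)).2.2.2 y.2.1 y.2.2 *
        D.N (j₂ w) s₁ y.1 s₂ (j₀ w) (z (inn.symm w)).1
          y.2.1 y.2.2 (z (inn.symm w)).2.1 (z (inn.symm w)).2.2.1)]
  simp only [Finset.sum_sigma, Finset.sum_product]
  simp only [Fintype.mem_piFinset, mem_sigma, mem_product, mem_Icc] at hz
  have hside := fun w => D.sum_side s₁ s₂ (z (out.symm w)).1 (z (inn.symm w)).1 (j₀ w) (j₂ w)
    (c₁' := (z (inn.symm w)).2.1) (c₂' := (z (inn.symm w)).2.2.1)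
    (hX' w) (hz (out.symm w)).2.2.1
    (by have := (hz (out.symm w)).2.2.2; rwa [Equiv.apply_symm_apply] at this)
  simp only [hside]
  rw [Finset.prod_ite_zero]
  simp only [mem_univ, true_implies]
  split_ifs
  -- The factors `1 / d` from orthogonality, one per side, cancel the factors `d` from the pentagon,
  -- one per corner.
  · have : ∏ w, 1 / D.d (z (inn.symm w)).1 = (∏ k, D.d (z k).1)⁻¹ := by
      rw [← inn.prod_comp, ← Finset.prod_inv_distrib]
      simp only [Equiv.symm_apply_apply, one_div]
    rw [this, mul_right_comm, mul_inv_cancel₀, one_mul]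
    exact Finset.prod_ne_zero_iff.mpr fun k _ => D.d_ne_zero _
  · rw [mul_zero]

-- By `hconn` the matching conditions make the fused string `s` and the fusion label constant around
-- the loop. What remains is the transfer matrix of `s`, counted once for each of the `δ(s₁, s₂,
-- s*)` fusion labels.
open Classical in
theorem loopCoeff_mul [Nonempty W]
    (hconn : ∀ f : W → D.A × ℕ, (∀ k, f (out k) = f (inn k)) → ∀ w w', f w = f w')
    (hX : D.deg s₁ + D.deg s₂ ∉ D.X) (hX' : ∀ w, D.deg (j₀ w) - D.deg s₂ ∉ D.X) :
    ∑ j ∈ Fintype.piFinset fun w => D.I (D.deg (j₀ w) - D.deg s₂),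
      ∑ C ∈ Fintype.piFinset fun k =>
          Icc 1 (D.δ (D.dual (j (out k))) (D.dual (outer k)) (j (inn k))),
        D.loopCoeff inn out outer s₁ j₂ j C₂ C * D.loopCoeff inn out outer s₂ j j₀ C C₀ =
    ∑ s ∈ D.I (D.deg s₁ + D.deg s₂),
      (D.δ s₁ s₂ (D.dual s) : 𝕜) * D.loopCoeff inn out outer s j₂ j₀ C₂ C₀ := by
  rw [loopCoeff_mul_transfer _ _ _ _ _ _ _ _ _ _ hX hX']
  have hR : ∀ s, (D.δ s₁ s₂ (D.dual s) : 𝕜) * D.loopCoeff inn out outer s j₂ j₀ C₂ C₀ =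
      ∑ _c ∈ Icc 1 (D.δ s₁ s₂ (D.dual s)), D.loopCoeff inn out outer s j₂ j₀ C₂ C₀ := by
    intro s
    rw [Finset.sum_const, Nat.card_Icc, nsmul_eq_mul, Nat.add_sub_cancel]
  simp only [hR]
  simp only [loopCoeff]
  simp only [Finset.sum_sigma']
  obtain ⟨w₀⟩ := ‹Nonempty W›
  symm
  -- A string `s`, a fusion label and one label per side give matching data at all corners; data
  -- outside the image violate some matching condition and contribute zero.
  refine Finset.sum_of_injOn (fun x k => ⟨x.1, x.2.2 (inn k), x.2.1, x.2.2 (out k)⟩) ?_ ?_ ?_ ?_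
  · rintro ⟨s, c, a⟩ _ ⟨s', c', a'⟩ _ h
    have h₀ : ∀ w, _ := fun w => congrFun h (inn.symm w)
    simp only [Sigma.mk.injEq, heq_eq_eq, Prod.mk.injEq, Equiv.apply_symm_apply] at h₀
    obtain ⟨rfl, -, rfl, -⟩ := h₀ w₀
    obtain rfl : a = a' := funext fun w => (h₀ w).2.1
    rfl
  · rintro ⟨s, c, a⟩ h
    simp only [coe_sigma, Set.mem_sigma_iff, mem_coe, mem_sigma, Fintype.mem_piFinset, mem_product,
      mem_Icc] at h ⊢
    refine fun k => ⟨h.1, h.2.2 _, h.2.1, ?_⟩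
    rw [← D.δ_rotate, D.dual_dual]
    exact h.2.2 _
  · intro z hz hnot
    simp only [Fintype.mem_piFinset, mem_sigma, mem_product, mem_Icc] at hz
    refine if_neg fun hall => hnot ?_
    have hc : ∀ w w', (fun w => ((z (inn.symm w)).1, (z (inn.symm w)).2.2.1)) w =
        (fun w => ((z (inn.symm w)).1, (z (inn.symm w)).2.2.1)) w' := by
      refine hconn _ fun k => ?_
      have := hall (out k)
      simp only [Equiv.symm_apply_apply] at this ⊢
      rw [this.1, this.2.1]
    have hc' : ∀ k, (z k).1 = (z (inn.symm w₀)).1 ∧ (z k).2.2.1 = (z (inn.symm w₀)).2.2.1 := by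
      intro k
      have := hc (inn k) w₀
      simpa only [Equiv.symm_apply_apply, Prod.mk.injEq] using this
    refine ⟨⟨(z (inn.symm w₀)).1, (z (inn.symm w₀)).2.2.1, fun w => (z (inn.symm w)).2.1⟩,
      ?_, ?_⟩
    · simp only [coe_sigma, Set.mem_sigma_iff, mem_coe, Fintype.mem_piFinset, mem_Icc]
      refine ⟨(hz _).1, (hz _).2.2.1, fun w => ?_⟩
      have := (hz (inn.symm w)).2.1
      rwa [(hc' (inn.symm w)).1, Equiv.apply_symm_apply] at this
    · funext k
      have h₁ := (hall (out k)).2.2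
      simp only [Equiv.symm_apply_apply] at h₁ ⊢
      rw [← (hc' k).1, ← (hc' k).2, ← h₁]
  · rintro ⟨s, c, a⟩ _
    simp

end Loop

end LWData

/-! ### The composition law for plaquettes; independence of the degree and idempotence -/

namespace TriangulatedSurface

variable {V : Type*} {S : TriangulatedSurface V} {p : V}

/-- Corners and the sides at which they are left. -/
noncomputable def Corner.inEquiv (S : TriangulatedSurface V) (p : V) : S.Corner p ≃ S.Side p :=
  Equiv.ofBijective _ Corner.sideIn_bijective

/-- Corners and the sides to which they lead. -/
noncomputable def Corner.outEquiv (S : TriangulatedSurface V) (p : V) : S.Corner p ≃ S.Side p :=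
  Equiv.ofBijective _ Corner.sideOut_bijective

/-- The flag of a corner. -/
def Corner.flag (c : S.Corner p) : S.Flag := ⟨(p, c.1.1, c.1.2), c.2⟩

theorem Corner.flag_e₁ (c : S.Corner p) : c.flag.e₁ = c.sideOut.edge.symm := rfl

theorem Corner.flag_e₂ (c : S.Corner p) : c.flag.e₂ = c.outer.symm := rfl

theorem Corner.flag_e₃ (c : S.Corner p) : c.flag.e₃ = c.sideIn.edge := rfl

theorem Side.edge_injective : Function.Injective (Side.edge : S.Side p → S.OEdge) := by
  intro w w' h
  exact Subtype.ext (congrArg (fun e : S.OEdge => e.fst) h)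

theorem Side.edge_ne_symm (w w' : S.Side p) : w.edge ≠ w'.edge.symm := by
  intro h
  exact w.2.ne (congrArg (fun e : S.OEdge => e.fst) h)

theorem Side.off_iff {e : S.OEdge} :
    ((∀ w : S.Side p, w.edge ≠ e) ∧ ∀ w : S.Side p, w.edge.symm ≠ e) ↔ e.fst ≠ p ∧ e.snd ≠ p := by
  obtain ⟨⟨a, b⟩, h⟩ := e
  constructor
  · rintro ⟨h₁, h₂⟩
    refine ⟨?_, ?_⟩
    · rintro rfl
      exact h₂ ⟨b, h.symm⟩ rfl
    · rintro rfl
      exact h₁ ⟨a, h⟩ rfl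
  · rintro ⟨h₁, h₂⟩
    refine ⟨fun w hw => h₂ ?_, fun w hw => h₁ ?_⟩
    · exact (congrArg (fun e : S.OEdge => e.snd) hw).symm
    · exact (congrArg (fun e : S.OEdge => e.fst) hw).symm

theorem Corner.outer_off (c : S.Corner p) : c.outer.fst ≠ p ∧ c.outer.snd ≠ p :=
  ⟨S.tri_ne (S.tri_rotate (S.tri_rotate c.2)), (S.tri_ne c.2).symm⟩

variable [DecidableEq V]

theorem Flag.off_of_notMem {f : S.Flag} (h : p ∉ f.face.1) (e : S.OEdge)
    (he : e = f.e₁ ∨ e = f.e₂ ∨ e = f.e₃) : e.fst ≠ p ∧ e.snd ≠ p := by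
  simp only [Flag.face, Finset.mem_insert, Finset.mem_singleton, not_or] at h
  obtain ⟨h₁, h₂, h₃⟩ := h
  rcases he with rfl | rfl | rfl
  exacts [⟨Ne.symm h₁, Ne.symm h₂⟩, ⟨Ne.symm h₂, Ne.symm h₃⟩, ⟨Ne.symm h₃, Ne.symm h₁⟩]

theorem Corner.forall_face_ne_iff {t : S.Face} : (∀ c : S.Corner p, c.face ≠ t) ↔ p ∉ t.1 := by
  constructor
  · intro h hp
    obtain ⟨c, hc⟩ := Face.exists_corner hp
    exact h c hc
  · rintro h c rfl
    exact h c.mem_face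

end TriangulatedSurface

section LinearMap

variable {R ι M₁ M₂ M₃ : Type*} [CommSemiring R] [AddCommMonoid M₁] [AddCommMonoid M₂]
  [AddCommMonoid M₃] [Module R M₁] [Module R M₂] [Module R M₃]

theorem sum_linearMap_comp (t : Finset ι) (f : ι → M₂ →ₗ[R] M₃) (h : M₁ →ₗ[R] M₂) :
    (∑ i ∈ t, f i) ∘ₗ h = ∑ i ∈ t, f i ∘ₗ h := by
  ext x
  simp

theorem linearMap_comp_sum (t : Finset ι) (f : ι → M₁ →ₗ[R] M₂) (h : M₂ →ₗ[R] M₃) :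
    h ∘ₗ (∑ i ∈ t, f i) = ∑ i ∈ t, h ∘ₗ f i := by
  ext x
  simp

end LinearMap

namespace LWData

open TriangulatedSurface Finset

variable {𝕜 : Type*} [Field 𝕜] [StarRing 𝕜] {G : Type*} [AddCommGroup G] (D : LWData 𝕜 G)

theorem N_ne_zero {j₁ j₂ j₃ j₄ j₅ j₆ : D.A} {a₁ a₂ a₃ a₄ : ℕ}
    (h : D.N j₁ j₂ j₃ j₄ j₅ j₆ a₁ a₂ a₃ a₄ ≠ 0) :
    (1 ≤ a₁ ∧ a₁ ≤ D.δ j₁ j₂ (D.dual j₃)) ∧ (1 ≤ a₂ ∧ a₂ ≤ D.δ j₃ j₄ (D.dual j₅)) ∧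
      (1 ≤ a₃ ∧ a₃ ≤ D.δ j₅ (D.dual j₆) (D.dual j₁)) ∧
      (1 ≤ a₄ ∧ a₄ ≤ D.δ j₆ (D.dual j₄) (D.dual j₂)) := by
  by_contra hn
  exact h (D.N_support _ _ _ _ _ _ _ _ _ _ hn)

/-- The support of `N` excludes the branching label `0`. This is why sums over intermediate states,
whose vertex labels start at `0`, reduce to labels starting at `1`. -/
theorem loopCoeff_ne_zero {W K : Type*} [Fintype W] [DecidableEq W] [Fintype K]
    {inn out : K → W} {outer : K → D.A} {s : D.A} {j' j : W → D.A} {C' C : K → ℕ}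
    (h : D.loopCoeff inn out outer s j' j C' C ≠ 0) (k : K) : C' k ≠ 0 ∧ C k ≠ 0 := by
  obtain ⟨a, -, ha⟩ := Finset.exists_ne_zero_of_sum_ne_zero h
  have hN := D.N_ne_zero (right_ne_zero_of_mul (Finset.prod_ne_zero_iff.mp ha k (mem_univ k)))
  have h₁ := hN.2.1.1
  have h₂ := hN.2.2.1.1
  omega

variable {V : Type*} [DecidableEq V] {S : TriangulatedSurface V}

section AgreeOff

variable {D} {p : V} {Φ₀ Φ₁ Φ₂ : S.Coloring G} {σ₀ : D.State Φ₀} {σ₁ : D.State Φ₁}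
  {σ₂ : D.State Φ₂}

theorem AgreeOff.symm (h : D.AgreeOff p σ₀ σ₁) : D.AgreeOff p σ₁ σ₀ :=
  ⟨fun e h₁ h₂ => (h.1 e h₁ h₂).symm, fun t ht => (h.2 t ht).symm⟩

theorem AgreeOff.trans (h : D.AgreeOff p σ₀ σ₁) (h' : D.AgreeOff p σ₁ σ₂) :
    D.AgreeOff p σ₀ σ₂ :=
  ⟨fun e h₁ h₂ => (h'.1 e h₁ h₂).trans (h.1 e h₁ h₂), fun t ht => (h'.2 t ht).trans (h.2 t ht)⟩

end AgreeOff

variable [Fintype V]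

open Classical in
theorem stringCoeff_eq (p : V) (s : D.A) {Φ Φ' : S.Coloring G} (σ' : D.State Φ')
    (σ : D.State Φ) : D.stringCoeff p s σ' σ = if D.AgreeOff p σ σ' then
      D.loopCoeff (Corner.inEquiv S p) (Corner.outEquiv S p) (fun c => σ.edge c.outer) s
        (fun w => σ'.edge w.edge) (fun w => σ.edge w.edge) (fun c => σ'.vert c.face)
        (fun c => σ.vert c.face) else 0 :=
  rfl

/-- A contributing intermediate state equals `σ₀` away from the boundary of `p`, so only its
boundary labels are summed and `loopCoeff_mul` applies. Admissibility of `Φ₁` supplies the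
genericity needed for orthogonality. -/
theorem sum_stringCoeff_mul (p : V) (s₁ s₂ : D.A) {Φ₀ Φ₁ Φ₂ : S.Coloring G}
    (hΦ : IsShift p (D.deg s₂) Φ₀ Φ₁) (hΦ₁ : D.Admissible Φ₁) (hX : D.deg s₁ + D.deg s₂ ∉ D.X)
    (σ₂ : D.State Φ₂) (σ₀ : D.State Φ₀) :
    ∑ σ₁ : D.State Φ₁, D.stringCoeff p s₁ σ₂ σ₁ * D.stringCoeff p s₂ σ₁ σ₀ =
      ∑ s ∈ D.I (D.deg s₁ + D.deg s₂),
        (D.δ s₁ s₂ (D.dual s) : 𝕜) * D.stringCoeff p s σ₂ σ₀ := by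
  classical
  simp only [D.stringCoeff_eq]
  by_cases hA : D.AgreeOff p σ₀ σ₂
  swap
  · rw [Finset.sum_eq_zero, Finset.sum_eq_zero]
    · intro s _
      rw [if_neg hA, mul_zero]
    · intro σ₁ _
      by_cases h₁ : D.AgreeOff p σ₀ σ₁
      · rw [if_neg (fun h₂ => hA (h₁.trans h₂)), zero_mul]
      · rw [if_neg h₁, mul_zero]
  simp only [if_pos hA]
  have hval : ∀ w : S.Side p, Φ₁.val w.edge = D.deg (σ₀.edge w.edge) - D.deg s₂ := fun w => by
    rw [hΦ.val_side, σ₀.deg_edge]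
  have := Side.nonempty S p
  rw [← D.loopCoeff_mul (Corner.inEquiv S p) (Corner.outEquiv S p) (fun c => σ₀.edge c.outer) s₁ s₂
    _ _ _ _ (fun f hf => Side.const_of_corner hf) hX
    (fun w => by rw [← hval]; exact hΦ₁ _)]
  -- The summand extended from states to arbitrary labellings, as `sum_state_eq` requires.
  let F : (S.OEdge → D.A) → (S.Face → ℕ) → 𝕜 := fun E U =>
    if (∀ e : S.OEdge, e.fst ≠ p → e.snd ≠ p → E e = σ₀.edge e) ∧
      (∀ t : S.Face, p ∉ t.1 → U t = σ₀.vert t) then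
      D.loopCoeff (Corner.inEquiv S p) (Corner.outEquiv S p) (fun c => σ₀.edge c.outer) s₁
        (fun w => σ₂.edge w.edge) (fun w => E w.edge) (fun c => σ₂.vert c.face)
        (fun c => U c.face) *
      D.loopCoeff (Corner.inEquiv S p) (Corner.outEquiv S p) (fun c => σ₀.edge c.outer) s₂
        (fun w => E w.edge) (fun w => σ₀.edge w.edge) (fun c => U c.face)
        (fun c => σ₀.vert c.face) else 0
  have hL : ∀ σ₁ : D.State Φ₁, (if D.AgreeOff p σ₁ σ₂ then
      D.loopCoeff (Corner.inEquiv S p) (Corner.outEquiv S p) (fun c => σ₁.edge c.outer) s₁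
        (fun w => σ₂.edge w.edge) (fun w => σ₁.edge w.edge) (fun c => σ₂.vert c.face)
        (fun c => σ₁.vert c.face) else 0) * (if D.AgreeOff p σ₀ σ₁ then
      D.loopCoeff (Corner.inEquiv S p) (Corner.outEquiv S p) (fun c => σ₀.edge c.outer) s₂
        (fun w => σ₁.edge w.edge) (fun w => σ₀.edge w.edge) (fun c => σ₁.vert c.face)
        (fun c => σ₀.vert c.face) else 0) = F σ₁.edge σ₁.vert := by
    intro σ₁
    by_cases h : D.AgreeOff p σ₀ σ₁
    · have hout : (fun c : S.Corner p => σ₁.edge c.outer) = fun c => σ₀.edge c.outer :=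
        funext fun c => h.1 _ c.outer_off.1 c.outer_off.2
      rw [if_pos h, if_pos (h.symm.trans hA), hout]
      exact (if_pos h).symm
    · rw [if_neg h, mul_zero]
      exact (if_neg h).symm
  rw [Finset.sum_congr rfl fun σ₁ _ => hL σ₁]
  have hface : ∀ t : S.Face, (∀ c : S.Corner p, c.flag.face ≠ t) ↔ p ∉ t.1 := fun t =>
    Corner.forall_face_ne_iff
  rw [D.sum_state_eq (ed := Side.edge (S := S) (p := p)) (fl := Corner.flag (S := S) (p := p))
    (E := σ₀.edge) (U := σ₀.vert) Side.edge_injective Side.edge_ne_symm Corner.face_injective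
    ?_ ?_ ?_ F ?_]
  · simp only [hval]
    refine Finset.sum_congr rfl fun j _ => ?_
    simp only [Corner.flag_e₁, Corner.flag_e₂, Corner.flag_e₃,
      D.patchEdge_symm Side.edge_injective Side.edge_ne_symm,
      D.patchEdge_apply Side.edge_injective]
    have hout : ∀ c : S.Corner p, D.patchEdge (Side.edge (S := S) (p := p)) σ₀.edge j c.outer.symm =
        D.dual (σ₀.edge c.outer) := by
      intro c
      have := Side.off_iff.mpr (And.symm c.outer_off : c.outer.symm.fst ≠ p ∧ c.outer.symm.snd ≠ p)
      rw [D.patchEdge_of_ne _ _ this.1 this.2, σ₀.edge_symm]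
    simp only [hout]
    refine Finset.sum_congr rfl fun C _ => ?_
    have hE : (fun w : S.Side p => D.patchEdge (Side.edge (S := S) (p := p)) σ₀.edge j w.edge) = j :=
      funext fun w => D.patchEdge_apply Side.edge_injective _ _ _
    have hU : (fun c : S.Corner p => patchVert Corner.flag σ₀.vert C c.face) = C :=
      funext fun c => patchVert_apply Corner.face_injective _ _ _
    simp only [F]
    rw [if_pos, hE, hU]
    refine ⟨fun e h₁ h₂ => ?_, fun t ht => ?_⟩
    · have := Side.off_iff.mpr ⟨h₁, h₂⟩
      exact D.patchEdge_of_ne _ _ this.1 this.2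
    · exact patchVert_of_ne _ _ ((hface t).mpr ht)
  · intro e h₁ h₂
    have := Side.off_iff.mp ⟨h₁, h₂⟩
    rw [σ₀.deg_edge, hΦ.val_of_ne this.1 this.2]
  · exact fun e _ _ => σ₀.edge_symm e
  · intro f hf
    exact ⟨σ₀.vert_le f, fun e he => Side.off_iff.mpr
      (Flag.off_of_notMem ((hface _).mp hf) e he)⟩
  · intro σ hσ
    have hc := (ite_ne_right_iff.mp hσ).1
    refine ⟨fun e h₁ h₂ => ?_, fun t ht => hc.2 t ((hface t).mp ht), fun c => ?_⟩
    · have := Side.off_iff.mp ⟨h₁, h₂⟩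
      exact hc.1 e this.1 this.2
    · exact (D.loopCoeff_ne_zero (right_ne_zero_of_mul (ite_ne_right_iff.mp hσ).2) c).1

theorem stringOp_comp (p : V) (s₁ s₂ : D.A) {Φ₀ Φ₁ Φ₂ : S.Coloring G}
    (hΦ : IsShift p (D.deg s₂) Φ₀ Φ₁) (hΦ₁ : D.Admissible Φ₁) (hX : D.deg s₁ + D.deg s₂ ∉ D.X) :
    D.stringOp p s₁ Φ₁ Φ₂ ∘ₗ D.stringOp p s₂ Φ₀ Φ₁ =
      ∑ s ∈ D.I (D.deg s₁ + D.deg s₂),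
        (D.δ s₁ s₂ (D.dual s) : 𝕜) • D.stringOp p s Φ₀ Φ₂ := by
  unfold stringOp
  rw [← Matrix.mulVecLin_mul]
  have : (Matrix.of fun (σ₂ : D.State Φ₂) (σ₁ : D.State Φ₁) => D.stringCoeff p s₁ σ₂ σ₁) *
      (Matrix.of fun (σ₁ : D.State Φ₁) (σ₀ : D.State Φ₀) => D.stringCoeff p s₂ σ₁ σ₀) =
      ∑ s ∈ D.I (D.deg s₁ + D.deg s₂), (D.δ s₁ s₂ (D.dual s) : 𝕜) •
        Matrix.of fun (σ₂ : D.State Φ₂) (σ₀ : D.State Φ₀) => D.stringCoeff p s σ₂ σ₀ := by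
    ext σ₂ σ₀
    rw [Matrix.mul_apply, Matrix.sum_apply]
    exact D.sum_stringCoeff_mul p s₁ s₂ hΦ hΦ₁ hX σ₂ σ₀
  rw [this]
  ext ψ : 1
  simp only [LinearMap.sum_apply, Matrix.mulVecLin_apply, LinearMap.smul_apply, Matrix.sum_mulVec,
    Matrix.smul_mulVec]

/-- Plaquette operators compose additively in the degree, through admissible colorings. -/
theorem gradedPlaquetteOp_comp (p : V) {g₁ g₂ : G} {Φ₀ Φ₁ Φ₂ : S.Coloring G}
    (hΦ : IsShift p g₂ Φ₀ Φ₁) (hΦ₁ : D.Admissible Φ₁) (h₁ : g₁ ∉ D.X) (h₂ : g₂ ∉ D.X)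
    (hX : g₁ + g₂ ∉ D.X) :
    D.gradedPlaquetteOp p g₁ Φ₁ Φ₂ ∘ₗ D.gradedPlaquetteOp p g₂ Φ₀ Φ₁ =
      D.gradedPlaquetteOp p (g₁ + g₂) Φ₀ Φ₂ := by
  unfold gradedPlaquetteOp
  -- The multiplicity in `b_fusion` is, up to rotation, the one produced by `stringOp_comp`.
  have hb : ∀ s ∈ D.I (g₁ + g₂), D.b s • D.stringOp p s Φ₀ Φ₂ =
      ∑ s₁ ∈ D.I g₁, ∑ s₂ ∈ D.I g₂, (D.b s₁ * D.b s₂) •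
        (D.δ s₁ s₂ (D.dual s) : 𝕜) • D.stringOp p s Φ₀ Φ₂ := by
    intro s hs
    rw [D.b_fusion g₁ g₂ h₁ h₂ s (by simpa using hs), Finset.sum_smul]
    refine Finset.sum_congr rfl fun s₁ _ => ?_
    rw [Finset.sum_smul]
    refine Finset.sum_congr rfl fun s₂ _ => ?_
    rw [D.δ_rotate, smul_smul]
  rw [Finset.sum_congr rfl hb, Finset.sum_comm, sum_linearMap_comp]
  refine Finset.sum_congr rfl fun s₁ hs₁ => ?_
  rw [Finset.sum_comm, linearMap_comp_sum]
  refine Finset.sum_congr rfl fun s₂ hs₂ => ?_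
  simp only [GradedLabels.mem_I] at hs₁ hs₂
  subst hs₁ hs₂
  rw [LinearMap.smul_comp, LinearMap.comp_smul, D.stringOp_comp p s₁ s₂ hΦ hΦ₁ hX, smul_smul,
    Finset.smul_sum]

theorem GenericAt.neg_notMem {D : LWData 𝕜 G} {Φ : S.Coloring G} {p : V} {g : G}
    (h : D.GenericAt Φ p g) : -g ∉ D.X := by
  rw [D.neg_mem_X_iff]; exact h.1

/-- The plaquette operator can be computed in any generic degree `h` that differs from `g`
generically. -/
theorem plaquetteOp_eq_of_sub {Φ : S.Coloring G} {p : V} {g h : G}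
    (hg : D.GenericAt Φ p g) (hh : D.GenericAt Φ p h) (hgh : h - g ∉ D.X) :
    D.plaquetteOp Φ p g = D.plaquetteOp Φ p h := by
  -- `B^{-g} = B^{h-g} B^{-h}`, through `Φ - h.δp`; below, `B^h = B^g B^{h-g}`, through `Φ - g.δp`.
  have h₁ : D.gradedPlaquetteOp p (-g) Φ (Φ + S.plaquetteColoring (-g) p) =
      D.gradedPlaquetteOp p (h - g) (Φ + S.plaquetteColoring (-h) p)
        (Φ + S.plaquetteColoring (-g) p) ∘ₗ
      D.gradedPlaquetteOp p (-h) Φ (Φ + S.plaquetteColoring (-h) p) := by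
    have e : h - g + -h = -g := by abel
    rw [D.gradedPlaquetteOp_comp p isShift_add hh.2 hgh hh.neg_notMem (by rw [e]; exact hg.neg_notMem),
      e]
  have h₂ : D.gradedPlaquetteOp p h (Φ + S.plaquetteColoring (-h) p) Φ =
      D.gradedPlaquetteOp p g (Φ + S.plaquetteColoring (-g) p) Φ ∘ₗ
      D.gradedPlaquetteOp p (h - g) (Φ + S.plaquetteColoring (-h) p)
        (Φ + S.plaquetteColoring (-g) p) := by
    have e : g + (h - g) = h := by abel
    have e' : - -h + -g = h - g := by abel
    -- State spaces depend on the coloring; stating the shift as a relation avoids transporting them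
    -- along equalities of colorings.
    have hs : IsShift p (- -h + -g) (Φ + S.plaquetteColoring (-h) p)
      (Φ + S.plaquetteColoring (-g) p) := IsShift.trans isShift_add.symm isShift_add
    rw [e'] at hs
    rw [D.gradedPlaquetteOp_comp p hs hg.2 hg.1 hgh (by rw [e]; exact hh.1), e]
  rw [plaquetteOp, plaquetteOp, h₁, h₂, LinearMap.comp_assoc]

/-- The difference `g' - g` need not be generic, so both operators are compared with a third degree
`h`. -/
theorem plaquetteOp_eq {Φ : S.Coloring G} (hΦ : D.Admissible Φ) {p : V} {g g' : G}
    (hg : D.GenericAt Φ p g) (hg' : D.GenericAt Φ p g') :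
    D.plaquetteOp Φ p g = D.plaquetteOp Φ p g' := by
  obtain ⟨h, hh, -, hY⟩ := D.exists_genericAt hΦ hΦ p (Set.toFinite {g, g'})
  rw [D.plaquetteOp_eq_of_sub hg hh (hY g (by simp)),
    D.plaquetteOp_eq_of_sub hg' hh (hY g' (by simp))]

/-- With the second factor computed in degree `h`, the last three operators of `B^g B^{-g} B^h
B^{-h}` collapse to `B^{-g}`. The step `B^{-g} B^h = B^{h-g}` passes through the admissible coloring
`Φ` itself. -/
theorem plaquetteOp_mul_self {Φ : S.Coloring G} (hΦ : D.Admissible Φ) {p : V} {g : G}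
    (hg : D.GenericAt Φ p g) :
    D.plaquetteOp Φ p g * D.plaquetteOp Φ p g = D.plaquetteOp Φ p g := by
  obtain ⟨h, hh, -, hY⟩ := D.exists_genericAt hΦ hΦ p (Set.toFinite {g})
  have hgh := hY g (by simp)
  have e : -g + h = h - g := by abel
  have e' : h - g + -h = -g := by abel
  have h₁ : D.gradedPlaquetteOp p (-g) Φ (Φ + S.plaquetteColoring (-g) p) ∘ₗ
      (D.gradedPlaquetteOp p h (Φ + S.plaquetteColoring (-h) p) Φ ∘ₗ
        D.gradedPlaquetteOp p (-h) Φ (Φ + S.plaquetteColoring (-h) p)) =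
      D.gradedPlaquetteOp p (-g) Φ (Φ + S.plaquetteColoring (-g) p) := by
    rw [← LinearMap.comp_assoc,
      D.gradedPlaquetteOp_comp p isShift_neg hΦ hg.neg_notMem hh.1 (by rwa [e]), e,
      D.gradedPlaquetteOp_comp p isShift_add hh.2 hgh hh.neg_notMem
        (by rw [e']; exact hg.neg_notMem), e']
  calc D.plaquetteOp Φ p g * D.plaquetteOp Φ p g
      = D.plaquetteOp Φ p g * D.plaquetteOp Φ p h := by rw [D.plaquetteOp_eq hΦ hg hh]
    _ = D.plaquetteOp Φ p g := by
      rw [plaquetteOp, plaquetteOp, Module.End.mul_eq_comp, LinearMap.comp_assoc, h₁]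

end LWData

/-! ### Exchange of two strings at a common side -/

section Sums

open Finset

theorem sum_comm_pair {α β γ δ R : Type*} [AddCommMonoid R] (s : Finset α) (t : Finset β)
    (u : Finset γ) (v : Finset δ) (f : α → β → γ → δ → R) :
    ∑ a ∈ s, ∑ b ∈ t, ∑ c ∈ u, ∑ d ∈ v, f a b c d =
      ∑ c ∈ u, ∑ d ∈ v, ∑ a ∈ s, ∑ b ∈ t, f a b c d := by
  simp only [← Finset.sum_product' s t, ← Finset.sum_product' u v]
  exact Finset.sum_comm

/-- The shape of the exchange: a kernel `T` may be applied at one end of the common side or,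
transposed, at the other. -/
theorem sum_transfer {α β R : Type*} [CommRing R] (s : Finset α) (t : Finset β) {k k' : R}
    (hk : k = k') (d g : α → R) (e h : β → R) (T : α → β → R) :
    ∑ a ∈ s, k * d a * ((∑ b ∈ t, e b * T a b * h b) * g a) =
      ∑ b ∈ t, k' * e b * ((∑ a ∈ s, d a * T a b * g a) * h b) := by
  subst hk
  simp only [Finset.mul_sum, Finset.sum_mul]
  rw [Finset.sum_comm]
  exact Finset.sum_congr rfl fun b _ => Finset.sum_congr rfl fun a _ => by ring

end Sums

namespace LWData

open Finset

variable {𝕜 : Type*} [Field 𝕜] [StarRing 𝕜] {G : Type*} [AddCommGroup G] (D : LWData 𝕜 G)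

/-- This and `N_symm₄` are further tetrahedral symmetries, composed from the two given generators.
-/
theorem N_symm₃ (j₁ j₂ j₃ j₄ j₅ j₆ : D.A) (a₁ a₂ a₃ a₄ : ℕ) :
    D.N j₁ j₂ j₃ j₄ j₅ j₆ a₁ a₂ a₃ a₄ =
      D.N (D.dual j₂) j₆ j₄ (D.dual j₅) (D.dual j₃) (D.dual j₁) a₄ a₂ a₁ a₃ := by
  rw [D.N_symm₁ j₁, D.N_symm₁ j₂, D.N_symm₂ (D.dual j₃)]
  simp only [D.dual_dual]

theorem N_symm₄ (j₁ j₂ j₃ j₄ j₅ j₆ : D.A) (a₁ a₂ a₃ a₄ : ℕ) :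
    D.N j₁ j₂ j₃ j₄ j₅ j₆ a₁ a₂ a₃ a₄ =
      D.N (D.dual j₄) (D.dual j₂) (D.dual j₆) (D.dual j₁) (D.dual j₅) (D.dual j₃) a₄ a₃ a₂ a₁ := by
  rw [D.N_symm₁ j₁, D.N_symm₂ j₂, D.N_symm₂ (D.dual j₁), D.N_symm₁ j₆]
  simp only [D.dual_dual]

/-- The part of the product of two plaquette operators that involves the common side of the
plaquettes. The labels `0` and `2` refer to the initial and the final state. -/
noncomputable def edgeCoeff (s t x₀ x₂ α₀ α₂ β₀ β₂ ζ₀ ζ₂ η₀ η₂ : D.A)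
    (a a' b b' c₀ c₂ c₀' c₂' : ℕ) : 𝕜 :=
  ∑ x ∈ D.I (D.deg x₂ + D.deg s), ∑ c ∈ Icc 1 (D.δ (D.dual x) (D.dual β₂) α₀),
    ∑ c' ∈ Icc 1 (D.δ x (D.dual ζ₀) η₂),
      (∑ A ∈ Icc 1 (D.δ x₂ s (D.dual x)),
        D.d α₂ * D.N α₂ s α₀ (D.dual x) β₂ (D.dual x₂) a c c₂ A *
          (D.d x₂ * D.N x₂ s x (D.dual ζ₀) (D.dual η₂) (D.dual ζ₂) A c' c₂' a')) *
      (∑ B ∈ Icc 1 (D.δ (D.dual x) t x₀),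
        D.d η₂ * D.N η₂ t η₀ x₀ ζ₀ x b' c₀' c' B *
          (D.d x * D.N (D.dual x) t (D.dual x₀) (D.dual β₀) (D.dual α₀) (D.dual β₂) B c₀ c b))

/-- Once the intermediate label of the side and the two string vertices on it are fixed, the sums at
its two ends separate. -/
theorem edgeCoeff_eq (s t x₀ x₂ α₀ α₂ β₀ β₂ ζ₀ ζ₂ η₀ η₂ : D.A)
    (a a' b b' c₀ c₂ c₀' c₂' : ℕ) :
    D.edgeCoeff s t x₀ x₂ α₀ α₂ β₀ β₂ ζ₀ ζ₂ η₀ η₂ a a' b b' c₀ c₂ c₀' c₂' =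
    ∑ X ∈ (D.I (D.deg x₂ + D.deg s)).sigma fun x =>
        Icc 1 (D.δ x₂ s (D.dual x)) ×ˢ Icc 1 (D.δ (D.dual x) t x₀),
      D.d α₂ * D.d x₂ * D.d η₂ * D.d X.1 *
      ((∑ c ∈ Icc 1 (D.δ (D.dual X.1) (D.dual β₂) α₀),
        D.N (D.dual X.1) t (D.dual x₀) (D.dual β₀) (D.dual α₀) (D.dual β₂) X.2.2 c₀ c b *
          D.N α₂ s α₀ (D.dual X.1) β₂ (D.dual x₂) a c c₂ X.2.1) *
      ∑ c' ∈ Icc 1 (D.δ X.1 (D.dual ζ₀) η₂),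
        D.N η₂ t η₀ x₀ ζ₀ X.1 b' c₀' c' X.2.2 *
          D.N x₂ s X.1 (D.dual ζ₀) (D.dual η₂) (D.dual ζ₂) X.2.1 c' c₂' a') := by
  rw [edgeCoeff, Finset.sum_sigma]
  refine Finset.sum_congr rfl fun x _ => ?_
  rw [Finset.sum_product]
  simp only [Finset.sum_mul_sum]
  simp only [Finset.mul_sum]
  rw [sum_comm_pair]
  refine Finset.sum_congr rfl fun A _ => Finset.sum_congr rfl fun B _ =>
    Finset.sum_congr rfl fun c _ => Finset.sum_congr rfl fun c' _ => by ring

/-- A pentagon at one end of the common side. The new label `n` is the intermediate label of the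
reversed side when the plaquettes act in the other order, and the inner sum on the right is the end
factor for that order. -/
theorem sum_common_left (s t x x₀ x₂ α₀ α₂ β₀ β₂ : D.A) (a b c₀ c₂ A B : ℕ)
    (hX : D.deg (D.dual x₂) + D.deg t ∉ D.X) :
    ∑ c ∈ Icc 1 (D.δ (D.dual x) (D.dual β₂) α₀),
      D.N (D.dual x) t (D.dual x₀) (D.dual β₀) (D.dual α₀) (D.dual β₂) B c₀ c b *
        D.N α₂ s α₀ (D.dual x) β₂ (D.dual x₂) a c c₂ A =
    ∑ Y ∈ (D.I (D.deg (D.dual x₂) + D.deg t)).sigma fun n =>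
        Icc 1 (D.δ (D.dual x₂) t (D.dual n)) ×ˢ Icc 1 (D.δ (D.dual n) s (D.dual x₀)),
      D.d Y.1 * D.N (D.dual s) (D.dual x₂) (D.dual x) t (D.dual x₀) Y.1 A B Y.2.2 Y.2.1 *
        ∑ c ∈ Icc 1 (D.δ Y.1 (D.dual β₀) α₂),
          D.N α₂ s α₀ (D.dual x₀) β₀ Y.1 a c₀ c Y.2.2 *
            D.N (D.dual x₂) t Y.1 (D.dual β₀) (D.dual α₂) (D.dual β₂) Y.2.1 c c₂ b := by
  have h := D.pentagon (D.dual α₀) (D.dual s) (D.dual x₂) t (D.dual β₀) (D.dual x) (D.dual x₀)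
    (D.dual α₂) (D.dual β₂) a A B c₀ c₂ b hX
  have hδ : ∀ n, D.δ (D.dual s) n x₀ = D.δ (D.dual n) s (D.dual x₀) := fun n => by
    rw [D.δ_dual (D.dual n), D.dual_dual, D.dual_dual, ← D.δ_rotate]
  simp only [D.dual_dual, hδ] at h
  have h₂ : ∀ c, D.N α₂ s α₀ (D.dual x) β₂ (D.dual x₂) a c c₂ A =
      D.N (D.dual s) (D.dual x₂) (D.dual x) (D.dual β₂) (D.dual α₀) (D.dual α₂) A c a c₂ :=
    fun c => D.N_symm₃ _ _ _ _ _ _ _ _ _ _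
  have h₃ : ∀ n c K, D.N α₂ s α₀ (D.dual x₀) β₀ n a c₀ c K =
      D.N (D.dual s) n (D.dual x₀) (D.dual β₀) (D.dual α₀) (D.dual α₂) K c₀ a c :=
    fun n c K => D.N_symm₃ _ _ _ _ _ _ _ _ _ _
  simp only [h₂, h₃]
  rw [← h, Finset.sum_sigma]
  refine Finset.sum_congr rfl fun n _ => ?_
  rw [Finset.sum_product_right]
  refine Finset.sum_congr rfl fun K _ => Finset.sum_congr rfl fun L _ => ?_
  rw [Finset.mul_sum]
  exact Finset.sum_congr rfl fun c _ => by ring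

/-- The same pentagon at the other end, with the strings exchanged. `N_symm₄` shows that its kernel
is the one in `sum_common_left`, now used from `n` to `x`. -/
theorem sum_common_right (s t n x₀ x₂ ζ₀ ζ₂ η₀ η₂ : D.A) (a' b' c₀' c₂' K L : ℕ)
    (hX : D.deg x₂ + D.deg s ∉ D.X) :
    ∑ c' ∈ Icc 1 (D.δ (D.dual n) (D.dual ζ₂) η₀),
      D.N η₂ t η₀ (D.dual n) ζ₂ x₂ b' c' c₂' L *
        D.N (D.dual n) s x₀ (D.dual ζ₀) (D.dual η₀) (D.dual ζ₂) K c₀' c' a' =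
    ∑ X ∈ (D.I (D.deg x₂ + D.deg s)).sigma fun x =>
        Icc 1 (D.δ x₂ s (D.dual x)) ×ˢ Icc 1 (D.δ (D.dual x) t x₀),
      D.d X.1 * D.N (D.dual s) (D.dual x₂) (D.dual X.1) t (D.dual x₀) n X.2.1 X.2.2 K L *
        ∑ c' ∈ Icc 1 (D.δ X.1 (D.dual ζ₀) η₂),
          D.N η₂ t η₀ x₀ ζ₀ X.1 b' c₀' c' X.2.2 *
            D.N x₂ s X.1 (D.dual ζ₀) (D.dual η₂) (D.dual ζ₂) X.2.1 c' c₂' a' := by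
  have h := D.sum_common_left t s n (D.dual x₀) (D.dual x₂) η₀ η₂ ζ₀ ζ₂ b' a' c₀' c₂' L K
    (by rwa [D.dual_dual])
  simp only [D.dual_dual] at h
  have h₁ : ∀ X : Σ _ : D.A, ℕ × ℕ,
      D.N (D.dual s) (D.dual x₂) (D.dual X.1) t (D.dual x₀) n X.2.1 X.2.2 K L =
        D.N (D.dual t) x₂ (D.dual n) s x₀ X.1 L K X.2.2 X.2.1 := fun X => by
    rw [D.N_symm₄]
    simp only [D.dual_dual]
  simp only [h₁]
  rw [← h]
  exact Finset.sum_congr rfl fun c _ => by ring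

/-- In the first order the end with labels `α, β` is rewritten, in the second the end with labels
`ζ, η`. Both become the same double sum over the intermediate labels of the two orders. -/
theorem edgeCoeff_swap (s t x₀ x₂ α₀ α₂ β₀ β₂ ζ₀ ζ₂ η₀ η₂ : D.A)
    (a a' b b' c₀ c₂ c₀' c₂' : ℕ) (hs : D.deg x₂ + D.deg s ∉ D.X)
    (ht : D.deg (D.dual x₂) + D.deg t ∉ D.X) :
    D.edgeCoeff s t x₀ x₂ α₀ α₂ β₀ β₂ ζ₀ ζ₂ η₀ η₂ a a' b b' c₀ c₂ c₀' c₂' =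
      D.edgeCoeff t s (D.dual x₀) (D.dual x₂) η₀ η₂ ζ₀ ζ₂ β₀ β₂ α₀ α₂ b' b a' a
        c₀' c₂' c₀ c₂ := by
  rw [edgeCoeff_eq, edgeCoeff_eq]
  simp only [D.dual_dual, D.d_dual]
  simp only [D.sum_common_left s t _ x₀ x₂ α₀ α₂ β₀ β₂ a b c₀ c₂ _ _ ht]
  have hr : ∀ n K L, ∑ c' ∈ Icc 1 (D.δ (D.dual n) (D.dual ζ₂) η₀),
      D.N (D.dual n) s x₀ (D.dual ζ₀) (D.dual η₀) (D.dual ζ₂) K c₀' c' a' *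
        D.N η₂ t η₀ (D.dual n) ζ₂ x₂ b' c' c₂' L = _ := fun n K L =>
    (Finset.sum_congr rfl fun c _ => mul_comm _ _).trans
      (D.sum_common_right s t n x₀ x₂ ζ₀ ζ₂ η₀ η₂ a' b' c₀' c₂' K L hs)
  simp only [hr]
  exact sum_transfer _ _ (by ring) _ _ _ _ _

end LWData

/-! ### Commutation of plaquette operators -/

open Finset in
theorem sum_piFinset_update {W β R : Type*} [Fintype W] [DecidableEq W] [AddCommMonoid R]
    (t : W → Finset β) (e : W) (z : β) (f : (W → β) → R) :
    ∑ a ∈ Fintype.piFinset t, f a =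
      ∑ a ∈ Fintype.piFinset fun w => if w = e then {z} else t w,
        ∑ A ∈ t e, f (Function.update a e A) := by
  rw [← Finset.sum_product']
  refine Finset.sum_nbij' (fun a => (Function.update a e z, a e))
    (fun x => Function.update x.1 e x.2) ?_ ?_ ?_ ?_ ?_
  · intro a ha
    simp only [mem_product, Fintype.mem_piFinset] at ha ⊢
    refine ⟨fun w => ?_, ha e⟩
    by_cases h : w = e
    · subst h; simp
    · simpa [h] using ha w
  · rintro ⟨a, A⟩ ha
    simp only [mem_product, Fintype.mem_piFinset] at ha ⊢
    intro w
    by_cases h : w = e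
    · subst h; simpa using ha.2
    · simpa [h] using ha.1 w
  · intro a _
    simp
  · rintro ⟨a, A⟩ ha
    simp only [mem_product, Fintype.mem_piFinset] at ha
    have := ha.1 e
    simp only [if_true, mem_singleton] at this
    simp [← this]
  · intro a _
    simp

open Finset in
theorem sum_piFinset_unit {β R : Type*} [AddCommMonoid R] (t : Unit → Finset β)
    (f : (Unit → β) → R) : ∑ a ∈ Fintype.piFinset t, f a = ∑ x ∈ t (), f fun _ => x := by
  refine Finset.sum_nbij' (fun a => a ()) (fun x _ => x) ?_ ?_ ?_ ?_ ?_ <;>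
    simp +contextual [Fintype.mem_piFinset]

open Finset in
theorem sum_piFinset_bool {β R : Type*} [AddCommMonoid R] (t : Bool → Finset β)
    (f : (Bool → β) → R) : ∑ a ∈ Fintype.piFinset t, f a =
      ∑ x ∈ t false, ∑ y ∈ t true, f fun k => cond k y x := by
  rw [← Finset.sum_product']
  refine Finset.sum_nbij' (fun a => (a false, a true)) (fun x k => cond k x.2 x.1) ?_ ?_ ?_ ?_ ?_
  · intro a ha
    simp only [mem_product, Fintype.mem_piFinset] at ha ⊢
    exact ⟨ha _, ha _⟩
  · rintro ⟨x, y⟩ h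
    simp only [mem_product, Fintype.mem_piFinset] at h ⊢
    rintro (_ | _)
    exacts [h.1, h.2]
  · intro a _
    funext k
    cases k <;> rfl
  · intro x _
    rfl
  · intro a _
    congr 1
    funext k
    cases k <;> rfl

namespace LWData

open TriangulatedSurface Finset

variable {𝕜 : Type*} [Field 𝕜] [StarRing 𝕜] {G : Type*} [AddCommGroup G] (D : LWData 𝕜 G)

section Split

variable {W K : Type*} [Fintype W] [DecidableEq W] [Fintype K] [DecidableEq K]

/-- The product over the corners other than `k₁` and `k₂`. -/
noncomputable def loopRest (inn out : K → W) (outer : K → D.A) (s : D.A) (j' j : W → D.A)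
    (C' C : K → ℕ) (k₁ k₂ : K) (a : W → ℕ) : 𝕜 :=
  ∏ k ∈ (univ.erase k₁).erase k₂, D.d (j' (inn k)) *
    D.N (j' (inn k)) s (j (inn k)) (D.dual (j (out k))) (outer k) (D.dual (j' (out k)))
      (a (inn k)) (C k) (C' k) (a (out k))

/-- Singling out the side `out k₁ = inn k₂`. -/
theorem loopCoeff_split (inn out : K ≃ W) (outer : K → D.A) (s : D.A) (j' j : W → D.A)
    (C' C : K → ℕ) {k₁ k₂ : K} (hk : k₁ ≠ k₂) {e : W} (h₁ : out k₁ = e) (h₂ : inn k₂ = e) :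
    D.loopCoeff inn out outer s j' j C' C =
      ∑ a ∈ Fintype.piFinset fun w => if w = e then {0} else Icc 1 (D.δ (j' w) s (D.dual (j w))),
        D.loopRest inn out outer s j' j C' C k₁ k₂ a *
          ∑ A ∈ Icc 1 (D.δ (j' e) s (D.dual (j e))),
            D.d (j' (inn k₁)) * D.N (j' (inn k₁)) s (j (inn k₁)) (D.dual (j e)) (outer k₁)
              (D.dual (j' e)) (a (inn k₁)) (C k₁) (C' k₁) A *
            (D.d (j' e) * D.N (j' e) s (j e) (D.dual (j (out k₂))) (outer k₂)
              (D.dual (j' (out k₂))) A (C k₂) (C' k₂) (a (out k₂))) := by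
  -- The label at `e` is summed separately; `0` is a dummy value that keeps `a` a function on all
  -- sides.
  rw [loopCoeff, sum_piFinset_update _ e 0]
  refine Finset.sum_congr rfl fun a _ => ?_
  rw [Finset.mul_sum]
  refine Finset.sum_congr rfl fun A _ => ?_
  have hin : ∀ k, k ≠ k₂ → inn k ≠ e := fun k h h' => h (inn.injective (h'.trans h₂.symm))
  have hout : ∀ k, k ≠ k₁ → out k ≠ e := fun k h h' => h (out.injective (h'.trans h₁.symm))
  rw [← Finset.mul_prod_erase univ _ (mem_univ k₁),
    ← Finset.mul_prod_erase (univ.erase k₁) _ (mem_erase.mpr ⟨hk.symm, mem_univ k₂⟩), loopRest]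
  rw [Finset.prod_congr rfl (g := fun k => D.d (j' (inn k)) *
    D.N (j' (inn k)) s (j (inn k)) (D.dual (j (out k))) (outer k) (D.dual (j' (out k)))
      (a (inn k)) (C k) (C' k) (a (out k)))]
  · simp only [h₁, h₂, Function.update_self, Function.update_of_ne (hin k₁ hk),
      Function.update_of_ne (hout k₂ hk.symm)]
    ring
  · intro k hk'
    simp only [mem_erase, mem_univ, and_true] at hk'
    rw [Function.update_of_ne (hin k hk'.1), Function.update_of_ne (hout k hk'.2)]

theorem loopRest_congr (inn out : K ≃ W) {outer outer' : K → D.A} {s : D.A} {i i' j j' : W → D.A}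
    {B B' C C' : K → ℕ} {k₁ k₂ : K} {e : W} (h₁ : out k₁ = e) (h₂ : inn k₂ = e)
    (ho : ∀ k, k ≠ k₁ → k ≠ k₂ → outer k = outer' k) (hi : ∀ w, w ≠ e → i w = i' w)
    (hj : ∀ w, w ≠ e → j w = j' w) (hB : ∀ k, k ≠ k₁ → k ≠ k₂ → B k = B' k)
    (hC : ∀ k, k ≠ k₁ → k ≠ k₂ → C k = C' k) (a : W → ℕ) :
    D.loopRest inn out outer s i j B C k₁ k₂ a = D.loopRest inn out outer' s i' j' B' C' k₁ k₂ a := by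
  refine Finset.prod_congr rfl fun k hk => ?_
  simp only [mem_erase, mem_univ, and_true] at hk
  have hin : inn k ≠ e := fun h => hk.1 (inn.injective (h.trans h₂.symm))
  have hout : out k ≠ e := fun h => hk.2 (out.injective (h.trans h₁.symm))
  rw [ho k hk.2 hk.1, hi _ hin, hi _ hout, hj _ hin, hj _ hout, hB k hk.2 hk.1, hC k hk.2 hk.1]

end Split

variable {V : Type*} [DecidableEq V] {S : TriangulatedSurface V}

/-- The labels `E'` on the boundary of the plaquette `q` and the labels `E` elsewhere. -/
def mixEdge (q : V) (E' E : S.OEdge → D.A) (e : S.OEdge) : D.A :=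
  if e.fst = q ∨ e.snd = q then E' e else E e

/-- The labels `U'` on the boundary of the plaquette `q` and the labels `U` elsewhere. -/
def mixVert (q : V) (U' U : S.Face → ℕ) (t : S.Face) : ℕ :=
  if q ∈ t.1 then U' t else U t

variable [Fintype V]

/-- After `q` has acted and before `p` acts, labels off the boundary of `q` are still initial, and
those on it but off the boundary of `p` are already final. Only the common edges `ed` and common
vertices `fl` remain to be summed. -/
theorem sum_stringCoeff_mix {ι κ : Type*} [Fintype ι] [DecidableEq ι] [Fintype κ] [DecidableEq κ]
    {ed : ι → S.OEdge} {fl : κ → S.Flag}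
    (hed : Function.Injective ed) (hsep : ∀ i i', ed i ≠ (ed i').symm)
    (hfl : Function.Injective fun k => (fl k).face) {p q : V}
    (hpq : ∀ e : S.OEdge, ((∀ i, ed i ≠ e) ∧ ∀ i, (ed i).symm ≠ e) ↔
      ((e.fst = q ∨ e.snd = q) → e.fst ≠ p ∧ e.snd ≠ p))
    (hpqf : ∀ t : S.Face, (∀ k, (fl k).face ≠ t) ↔ (q ∈ t.1 → p ∉ t.1))
    (s t : D.A) {Φ₀ Φ₁ Φ₂ : S.Coloring G} (h₀₁ : IsShift q (D.deg t) Φ₀ Φ₁)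
    (h₁₂ : IsShift p (D.deg s) Φ₁ Φ₂) (σ₂ : D.State Φ₂) (σ₀ : D.State Φ₀)
    (hE : ∀ e : S.OEdge, e.fst ≠ p → e.snd ≠ p → e.fst ≠ q → e.snd ≠ q →
      σ₂.edge e = σ₀.edge e)
    (hV : ∀ t : S.Face, p ∉ t.1 → q ∉ t.1 → σ₂.vert t = σ₀.vert t) :
    ∑ σ₁ : D.State Φ₁, D.stringCoeff p s σ₂ σ₁ * D.stringCoeff q t σ₁ σ₀ =
      ∑ j ∈ Fintype.piFinset fun i => D.I (Φ₁.val (ed i)),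
        ∑ C ∈ Fintype.piFinset fun k =>
            Icc 1 (D.δ (D.patchEdge ed (D.mixEdge q σ₂.edge σ₀.edge) j (fl k).e₁)
              (D.patchEdge ed (D.mixEdge q σ₂.edge σ₀.edge) j (fl k).e₂)
              (D.patchEdge ed (D.mixEdge q σ₂.edge σ₀.edge) j (fl k).e₃)),
          D.loopCoeff (Corner.inEquiv S p) (Corner.outEquiv S p) (fun c => σ₂.edge c.outer) s
            (fun w => σ₂.edge w.edge)
            (fun w => D.patchEdge ed (D.mixEdge q σ₂.edge σ₀.edge) j w.edge)
            (fun c => σ₂.vert c.face)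
            (fun c => patchVert fl (mixVert q σ₂.vert σ₀.vert) C c.face) *
          D.loopCoeff (Corner.inEquiv S q) (Corner.outEquiv S q) (fun c => σ₀.edge c.outer) t
            (fun w => D.patchEdge ed (D.mixEdge q σ₂.edge σ₀.edge) j w.edge)
            (fun w => σ₀.edge w.edge)
            (fun c => patchVert fl (mixVert q σ₂.vert σ₀.vert) C c.face)
            (fun c => σ₀.vert c.face) := by
  classical
  let F : (S.OEdge → D.A) → (S.Face → ℕ) → 𝕜 := fun E U =>
    if ((∀ e : S.OEdge, e.fst ≠ p → e.snd ≠ p → σ₂.edge e = E e) ∧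
      (∀ t : S.Face, p ∉ t.1 → σ₂.vert t = U t)) ∧
      ((∀ e : S.OEdge, e.fst ≠ q → e.snd ≠ q → E e = σ₀.edge e) ∧
      (∀ t : S.Face, q ∉ t.1 → U t = σ₀.vert t)) then
      D.loopCoeff (Corner.inEquiv S p) (Corner.outEquiv S p) (fun c => σ₂.edge c.outer) s
        (fun w => σ₂.edge w.edge) (fun w => E w.edge) (fun c => σ₂.vert c.face)
        (fun c => U c.face) *
      D.loopCoeff (Corner.inEquiv S q) (Corner.outEquiv S q) (fun c => σ₀.edge c.outer) t
        (fun w => E w.edge) (fun w => σ₀.edge w.edge) (fun c => U c.face)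
        (fun c => σ₀.vert c.face) else 0
  have hL : ∀ σ₁ : D.State Φ₁, D.stringCoeff p s σ₂ σ₁ * D.stringCoeff q t σ₁ σ₀ =
      F σ₁.edge σ₁.vert := by
    intro σ₁
    rw [D.stringCoeff_eq, D.stringCoeff_eq]
    by_cases h : D.AgreeOff p σ₁ σ₂
    · by_cases h' : D.AgreeOff q σ₀ σ₁
      · have hout : (fun c : S.Corner p => σ₁.edge c.outer) = fun c => σ₂.edge c.outer :=
          funext fun c => (h.1 _ c.outer_off.1 c.outer_off.2).symm
        rw [if_pos h, if_pos h', hout]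
        exact (if_pos ⟨h, h'⟩).symm
      · rw [if_neg h', mul_zero]
        exact (if_neg fun hh => h' hh.2).symm
    · rw [if_neg h, zero_mul]
      exact (if_neg fun hh => h hh.1).symm
  rw [Finset.sum_congr rfl fun σ₁ _ => hL σ₁]
  rw [D.sum_state_eq (ed := ed) (fl := fl)
    (E := D.mixEdge q σ₂.edge σ₀.edge) (U := mixVert q σ₂.vert σ₀.vert) hed hsep hfl
    ?_ ?_ ?_ F ?_]
  · refine Finset.sum_congr rfl fun j _ => Finset.sum_congr rfl fun C _ => ?_
    refine if_pos ⟨⟨fun e h₁ h₂ => ?_, fun t h => ?_⟩, ⟨fun e h₁ h₂ => ?_, fun t h => ?_⟩⟩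
    · have := (hpq e).mpr fun _ => ⟨h₁, h₂⟩
      rw [D.patchEdge_of_ne _ _ this.1 this.2, mixEdge]
      split_ifs with hq
      · rfl
      · push Not at hq
        exact hE e h₁ h₂ hq.1 hq.2
    · rw [patchVert_of_ne _ _ ((hpqf t).mpr fun _ => h), mixVert]
      split_ifs with hq
      · rfl
      · exact hV t h hq
    · have := (hpq e).mpr fun h => absurd h (by tauto)
      rw [D.patchEdge_of_ne _ _ this.1 this.2, mixEdge, if_neg (by tauto)]
    · rw [patchVert_of_ne _ _ ((hpqf t).mpr fun h' => absurd h' h), mixVert, if_neg h]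
  · intro e h₁ h₂
    have := (hpq e).mp ⟨h₁, h₂⟩
    rw [mixEdge]
    split_ifs with hq
    · rw [σ₂.deg_edge, h₁₂.val_of_ne (this hq).1 (this hq).2]
    · push Not at hq
      rw [σ₀.deg_edge, h₀₁.val_of_ne hq.1 hq.2]
  · intro e _ _
    have : (e.symm.fst = q ∨ e.symm.snd = q) ↔ (e.fst = q ∨ e.snd = q) := or_comm
    simp only [mixEdge, this]
    split_ifs
    · exact σ₂.edge_symm e
    · exact σ₀.edge_symm e
  · intro f hf
    have hf' := (hpqf _).mp hf
    rw [mixVert]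
    split_ifs with hq
    · have hp := hf' hq
      have hoff := Flag.off_of_notMem hp
      have hm : ∀ e, e = f.e₁ ∨ e = f.e₂ ∨ e = f.e₃ →
          D.mixEdge q σ₂.edge σ₀.edge e = σ₂.edge e := by
        intro e he
        rw [mixEdge]
        split_ifs with hqe
        · rfl
        · push Not at hqe
          exact (hE e (hoff e he).1 (hoff e he).2 hqe.1 hqe.2).symm
      rw [hm _ (Or.inl rfl), hm _ (Or.inr (Or.inl rfl)), hm _ (Or.inr (Or.inr rfl))]
      exact ⟨σ₂.vert_le f, fun e he => (hpq e).mpr fun _ => hoff e he⟩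
    · have hoff := Flag.off_of_notMem hq
      have hm : ∀ e, e = f.e₁ ∨ e = f.e₂ ∨ e = f.e₃ →
          D.mixEdge q σ₂.edge σ₀.edge e = σ₀.edge e := by
        intro e he
        rw [mixEdge, if_neg (by have := hoff e he; tauto)]
      rw [hm _ (Or.inl rfl), hm _ (Or.inr (Or.inl rfl)), hm _ (Or.inr (Or.inr rfl))]
      exact ⟨σ₀.vert_le f, fun e he => (hpq e).mpr fun h => absurd h (by
        have := hoff e he; tauto)⟩
  · intro σ hσ
    obtain ⟨⟨⟨hp₁, hp₂⟩, hq₁, hq₂⟩, hne⟩ := ite_ne_right_iff.mp hσ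
    refine ⟨fun e h₁ h₂ => ?_, fun t ht => ?_, fun k => ?_⟩
    · have := (hpq e).mp ⟨h₁, h₂⟩
      rw [mixEdge]
      split_ifs with hq
      · exact (hp₁ e (this hq).1 (this hq).2).symm
      · push Not at hq
        exact hq₁ e hq.1 hq.2
    · have := (hpqf t).mp ht
      rw [mixVert]
      split_ifs with hq
      · exact (hp₂ t (this hq)).symm
      · exact hq₂ t hq
    · have hmem : p ∈ (fl k).face.1 := by
        by_contra hn
        exact ((hpqf (fl k).face).mpr fun _ => hn) k rfl
      obtain ⟨c, hc⟩ := Face.exists_corner hmem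
      rw [← hc]
      exact (D.loopCoeff_ne_zero (left_ne_zero_of_mul hne) c).2

/-- The boundaries are disjoint, so the intermediate state is unique; the resulting product is
visibly symmetric in the two plaquettes. -/
theorem sum_stringCoeff_of_not_adj {p q : V} (hne : p ≠ q) (hadj : ¬ S.graph.Adj p q)
    (s t : D.A) {Φ₀ Φ₁ Φ₂ : S.Coloring G} (h₀₁ : IsShift q (D.deg t) Φ₀ Φ₁)
    (h₁₂ : IsShift p (D.deg s) Φ₁ Φ₂) (σ₂ : D.State Φ₂) (σ₀ : D.State Φ₀)
    (hE : ∀ e : S.OEdge, e.fst ≠ p → e.snd ≠ p → e.fst ≠ q → e.snd ≠ q →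
      σ₂.edge e = σ₀.edge e)
    (hV : ∀ t : S.Face, p ∉ t.1 → q ∉ t.1 → σ₂.vert t = σ₀.vert t) :
    ∑ σ₁ : D.State Φ₁, D.stringCoeff p s σ₂ σ₁ * D.stringCoeff q t σ₁ σ₀ =
      D.loopCoeff (Corner.inEquiv S p) (Corner.outEquiv S p) (fun c => σ₀.edge c.outer) s
        (fun w => σ₂.edge w.edge) (fun w => σ₀.edge w.edge) (fun c => σ₂.vert c.face)
        (fun c => σ₀.vert c.face) *
      D.loopCoeff (Corner.inEquiv S q) (Corner.outEquiv S q) (fun c => σ₀.edge c.outer) t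
        (fun w => σ₂.edge w.edge) (fun w => σ₀.edge w.edge) (fun c => σ₂.vert c.face)
        (fun c => σ₀.vert c.face) := by
  have hadj' : ¬ S.graph.Adj q p := fun h => hadj h.symm
  have hedge : ∀ e : S.OEdge, (e.fst = q ∨ e.snd = q) → e.fst ≠ p ∧ e.snd ≠ p := by
    rintro ⟨⟨a, b⟩, h⟩ (rfl | rfl)
    · exact ⟨hne.symm, fun hb => hadj' (hb ▸ h)⟩
    · exact ⟨fun ha => hadj (ha ▸ h), hne.symm⟩
  have hface : ∀ t : S.Face, q ∈ t.1 → p ∉ t.1 := by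
    intro t hq hp
    obtain ⟨c, rfl⟩ := Face.exists_corner hq
    have h₁ : S.graph.Adj q c.1.1 := ⟨_, c.2⟩
    have h₂ : S.graph.Adj q c.1.2 := c.sideIn.2.symm
    simp only [Corner.face, Flag.face, Finset.mem_insert, Finset.mem_singleton] at hp
    rcases hp with h | h | h
    · exact hne h
    · exact hadj' (h ▸ h₁)
    · exact hadj' (h ▸ h₂)
  rw [D.sum_stringCoeff_mix (ι := Empty) (κ := Empty) (ed := Empty.elim) (fl := Empty.elim)
    (fun i => i.elim) (fun i => i.elim) (fun i => i.elim)
    (fun e => ⟨fun _ => hedge e, fun _ => ⟨fun i => i.elim, fun i => i.elim⟩⟩)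
    (fun t => ⟨fun _ => hface t, fun _ i => i.elim⟩) s t h₀₁ h₁₂ σ₂ σ₀ hE hV]
  simp only [Fintype.piFinset_of_isEmpty, Finset.univ_unique, Finset.sum_singleton]
  have hP : ∀ (j : Empty → D.A) (e : S.OEdge), D.patchEdge (Empty.elim : Empty → S.OEdge)
      (D.mixEdge q σ₂.edge σ₀.edge) j e = D.mixEdge q σ₂.edge σ₀.edge e :=
    fun _ e => D.patchEdge_of_ne _ _ (fun i => i.elim) (fun i => i.elim)
  have hU : ∀ (C : Empty → ℕ) (t : S.Face), patchVert (Empty.elim : Empty → S.Flag)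
      (mixVert q σ₂.vert σ₀.vert) C t = mixVert q σ₂.vert σ₀.vert t :=
    fun _ e => patchVert_of_ne _ _ (fun i => i.elim)
  simp only [hP, hU]
  have e₁ : ∀ c : S.Corner p, σ₂.edge c.outer = σ₀.edge c.outer := by
    intro c
    have hq : ¬ (c.outer.fst = q ∨ c.outer.snd = q) := by
      rintro (h | h)
      · exact hadj (h ▸ c.sideIn.2.symm)
      · exact hadj (h ▸ ⟨_, c.2⟩)
    push Not at hq
    exact hE _ c.outer_off.1 c.outer_off.2 hq.1 hq.2
  have e₂ : ∀ w : S.Side p, D.mixEdge q σ₂.edge σ₀.edge w.edge = σ₀.edge w.edge := by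
    intro w
    refine if_neg fun h => ?_
    exact (hedge _ h).2 rfl
  have e₃ : ∀ w : S.Side q, D.mixEdge q σ₂.edge σ₀.edge w.edge = σ₂.edge w.edge :=
    fun w => if_pos (Or.inr rfl)
  have e₄ : ∀ c : S.Corner p, mixVert q σ₂.vert σ₀.vert c.face = σ₀.vert c.face :=
    fun c => if_neg fun h => hface _ h c.mem_face
  have e₅ : ∀ c : S.Corner q, mixVert q σ₂.vert σ₀.vert c.face = σ₂.vert c.face :=
    fun c => if_pos c.mem_face
  simp only [e₁, e₂, e₃, e₄, e₅]

end LWData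

theorem sum_comm_last {α β γ R : Type*} [AddCommMonoid R] (s : Finset α) (t : Finset β)
    (u : Finset γ) (f : α → β → γ → R) :
    ∑ a ∈ s, ∑ b ∈ t, ∑ c ∈ u, f a b c = ∑ c ∈ u, ∑ a ∈ s, ∑ b ∈ t, f a b c := by
  rw [Finset.sum_comm (s := u)]
  exact Finset.sum_congr rfl fun a _ => Finset.sum_comm

open Finset in
theorem sum_mul_sum_pull {α β γ X R : Type*} [CommRing R] (I : Finset X) (T T' : X → Finset γ)
    (s : Finset α) (t : Finset β) (r : α → R) (r' : β → R) (f : X → γ → γ → α → R)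
    (g : X → γ → γ → β → R) :
    ∑ x ∈ I, ∑ c ∈ T x, ∑ c' ∈ T' x,
      (∑ a ∈ s, r a * f x c c' a) * ∑ b ∈ t, r' b * g x c c' b =
    ∑ a ∈ s, ∑ b ∈ t, r a * r' b *
      ∑ x ∈ I, ∑ c ∈ T x, ∑ c' ∈ T' x, f x c c' a * g x c c' b := by
  simp only [Finset.sum_mul_sum]
  simp only [Finset.mul_sum]
  rw [sum_comm_last]
  refine Finset.sum_congr rfl fun x _ => ?_
  rw [sum_comm_last]
  refine Finset.sum_congr rfl fun c _ => ?_
  rw [sum_comm_last]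
  exact Finset.sum_congr rfl fun c' _ => Finset.sum_congr rfl fun a _ =>
    Finset.sum_congr rfl fun b _ => by ring

namespace LWData

open TriangulatedSurface Finset

variable {𝕜 : Type*} [Field 𝕜] [StarRing 𝕜] {G : Type*} [AddCommGroup G] (D : LWData 𝕜 G)
  {V : Type*} [DecidableEq V] {S : TriangulatedSurface V} [Fintype V]

/-- Singling out the side `q` of the plaquette `p`, where `u, q, v` are consecutive sides. -/
theorem loopCoeff_corner_split {p q u v : V} (hu : S.tri p q u) (hv : S.tri p v q)
    (hqp : S.graph.Adj q p) (hup : S.graph.Adj u p) (hvp : S.graph.Adj v p)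
    (O : S.Corner p → D.A) (s : D.A) (E' E : S.OEdge → D.A) (U' U : S.Face → ℕ) :
    D.loopCoeff (Corner.inEquiv S p) (Corner.outEquiv S p) O s (fun w => E' w.edge)
      (fun w => E w.edge) (fun c => U' c.face) (fun c => U c.face) =
    ∑ a ∈ Fintype.piFinset fun w : S.Side p => if w = ⟨q, hqp⟩ then {0} else
        Icc 1 (D.δ (E' w.edge) s (D.dual (E w.edge))),
      D.loopRest (Corner.inEquiv S p) (Corner.outEquiv S p) O s (fun w => E' w.edge)
        (fun w => E w.edge) (fun c => U' c.face) (fun c => U c.face) ⟨(q, u), hu⟩ ⟨(v, q), hv⟩ a *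
      ∑ A ∈ Icc 1 (D.δ (E' ⟨(q, p), hqp⟩) s (D.dual (E ⟨(q, p), hqp⟩))),
        D.d (E' ⟨(u, p), hup⟩) * D.N (E' ⟨(u, p), hup⟩) s (E ⟨(u, p), hup⟩)
          (D.dual (E ⟨(q, p), hqp⟩)) (O ⟨(q, u), hu⟩) (D.dual (E' ⟨(q, p), hqp⟩))
          (a ⟨u, hup⟩) (U (Flag.face ⟨(p, q, u), hu⟩)) (U' (Flag.face ⟨(p, q, u), hu⟩)) A *
        (D.d (E' ⟨(q, p), hqp⟩) * D.N (E' ⟨(q, p), hqp⟩) s (E ⟨(q, p), hqp⟩)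
          (D.dual (E ⟨(v, p), hvp⟩)) (O ⟨(v, q), hv⟩) (D.dual (E' ⟨(v, p), hvp⟩))
          A (U (Flag.face ⟨(p, v, q), hv⟩)) (U' (Flag.face ⟨(p, v, q), hv⟩)) (a ⟨v, hvp⟩)) := by
  classical
  have hk : (⟨(q, u), hu⟩ : S.Corner p) ≠ ⟨(v, q), hv⟩ := by
    intro h
    exact S.tri_ne (S.tri_rotate hv) (congrArg (fun c : S.Corner p => c.1.1) h).symm
  exact D.loopCoeff_split (Corner.inEquiv S p) (Corner.outEquiv S p) O s (fun w => E' w.edge)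
    (fun w => E w.edge) (fun c => U' c.face) (fun c => U c.face) hk (e := ⟨q, hqp⟩) rfl rfl

theorem face_rotate {p q u : V} (hu : S.tri p q u) (hu' : S.tri q u p) :
    Flag.face (⟨(q, u, p), hu'⟩ : S.Flag) = Flag.face (⟨(p, q, u), hu⟩ : S.Flag) := by
  refine Subtype.ext ?_
  ext t
  simp only [Flag.face, Finset.mem_insert, Finset.mem_singleton]
  tauto

/-- Adjacent plaquettes share exactly the edge dual to `pq` and its ends, the triangles `pqu` and
`qpv`. The remaining factors see only initial and final labels, which leaves `edgeCoeff` as the part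
that could depend on the order. -/
theorem sum_stringCoeff_of_adj {p q u v : V} (hu : S.tri p q u) (hv : S.tri q p v)
    (hu' : S.tri q u p) (hv' : S.tri p v q)
    (hqp : S.graph.Adj q p) (hpq : S.graph.Adj p q) (hup : S.graph.Adj u p)
    (huq : S.graph.Adj u q) (hvp : S.graph.Adj v p) (hvq : S.graph.Adj v q)
    (s t : D.A) {Φ₀ Φ₁ Φ₂ : S.Coloring G} (h₀₁ : IsShift q (D.deg t) Φ₀ Φ₁)
    (h₁₂ : IsShift p (D.deg s) Φ₁ Φ₂) (σ₂ : D.State Φ₂) (σ₀ : D.State Φ₀)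
    (hE : ∀ e : S.OEdge, e.fst ≠ p → e.snd ≠ p → e.fst ≠ q → e.snd ≠ q →
      σ₂.edge e = σ₀.edge e)
    (hV : ∀ t : S.Face, p ∉ t.1 → q ∉ t.1 → σ₂.vert t = σ₀.vert t) :
    ∑ σ₁ : D.State Φ₁, D.stringCoeff p s σ₂ σ₁ * D.stringCoeff q t σ₁ σ₀ =
      ∑ a ∈ Fintype.piFinset fun w : S.Side p => if w = ⟨q, hqp⟩ then {0} else
          Icc 1 (D.δ (σ₂.edge w.edge) s (D.dual (σ₀.edge w.edge))),
      ∑ b ∈ Fintype.piFinset fun w : S.Side q => if w = ⟨p, hpq⟩ then {0} else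
          Icc 1 (D.δ (σ₂.edge w.edge) t (D.dual (σ₀.edge w.edge))),
        D.loopRest (Corner.inEquiv S p) (Corner.outEquiv S p) (fun c => σ₀.edge c.outer) s
          (fun w => σ₂.edge w.edge) (fun w => σ₀.edge w.edge) (fun c => σ₂.vert c.face)
          (fun c => σ₀.vert c.face) ⟨(q, u), hu⟩ ⟨(v, q), hv'⟩ a *
        D.loopRest (Corner.inEquiv S q) (Corner.outEquiv S q) (fun c => σ₀.edge c.outer) t
          (fun w => σ₂.edge w.edge) (fun w => σ₀.edge w.edge) (fun c => σ₂.vert c.face)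
          (fun c => σ₀.vert c.face) ⟨(p, v), hv⟩ ⟨(u, p), hu'⟩ b *
        D.edgeCoeff s t (σ₀.edge ⟨(q, p), hqp⟩) (σ₂.edge ⟨(q, p), hqp⟩)
          (σ₀.edge ⟨(u, p), hup⟩) (σ₂.edge ⟨(u, p), hup⟩)
          (σ₀.edge ⟨(u, q), huq⟩) (σ₂.edge ⟨(u, q), huq⟩)
          (σ₀.edge ⟨(v, p), hvp⟩) (σ₂.edge ⟨(v, p), hvp⟩)
          (σ₀.edge ⟨(v, q), hvq⟩) (σ₂.edge ⟨(v, q), hvq⟩)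
          (a ⟨u, hup⟩) (a ⟨v, hvp⟩) (b ⟨u, huq⟩) (b ⟨v, hvq⟩)
          (σ₀.vert (Flag.face ⟨(p, q, u), hu⟩)) (σ₂.vert (Flag.face ⟨(p, q, u), hu⟩))
          (σ₀.vert (Flag.face ⟨(q, p, v), hv⟩)) (σ₂.vert (Flag.face ⟨(q, p, v), hv⟩)) := by
  classical
  have npq : p ≠ q := hpq.ne
  have nup : u ≠ p := hup.ne
  have nuq : u ≠ q := huq.ne
  have nvp : v ≠ p := hvp.ne
  have nvq : v ≠ q := hvq.ne
  have fu := face_rotate hu hu'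
  have fv := face_rotate hv hv'
  let ed : Unit → S.OEdge := fun _ => ⟨(q, p), hqp⟩
  let fl : Bool → S.Flag := fun k => cond k ⟨(q, p, v), hv⟩ ⟨(p, q, u), hu⟩
  have hfl₀ : (Flag.face ⟨(p, q, u), hu⟩ : S.Face) ≠ Flag.face ⟨(q, p, v), hv⟩ := by
    intro h
    have : (⟨(q, u), hu⟩ : S.Corner p) = ⟨(v, q), hv'⟩ := Corner.face_injective (h.trans fv.symm)
    exact nvq (congrArg (fun c : S.Corner p => c.1.1) this).symm
  have hfl : Function.Injective fun k => (fl k).face := by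
    rintro (_ | _) (_ | _) h
    exacts [rfl, absurd h hfl₀, absurd h.symm hfl₀, rfl]
  have hed : Function.Injective ed := fun _ _ _ => rfl
  have hsep : ∀ i i', ed i ≠ (ed i').symm := fun _ _ h =>
    npq (congrArg (fun e : S.OEdge => e.fst) h).symm
  have hpqe : ∀ e : S.OEdge, ((∀ i, ed i ≠ e) ∧ ∀ i, (ed i).symm ≠ e) ↔
      ((e.fst = q ∨ e.snd = q) → e.fst ≠ p ∧ e.snd ≠ p) := by
    rintro ⟨⟨a, b⟩, hab⟩
    constructor
    · rintro ⟨h₁, h₂⟩ (rfl | rfl)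
      · refine ⟨npq.symm, ?_⟩
        rintro rfl
        exact h₁ () rfl
      · refine ⟨?_, npq.symm⟩
        rintro rfl
        exact h₂ () rfl
    · intro h
      refine ⟨fun _ he => ?_, fun _ he => ?_⟩
      · have h₁ : q = a := congrArg (fun e : S.OEdge => e.fst) he
        have h₂ : p = b := congrArg (fun e : S.OEdge => e.snd) he
        exact (h (Or.inl h₁.symm)).2 h₂.symm
      · have h₁ : p = a := congrArg (fun e : S.OEdge => e.fst) he
        have h₂ : q = b := congrArg (fun e : S.OEdge => e.snd) he
        exact (h (Or.inr h₂.symm)).1 h₁.symm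
  -- An oriented edge lies in only one positive triangle, so no third triangle contains both `p` and
  -- `q`.
  have hcorner : ∀ c : S.Corner p, q ∈ c.face.1 → c = ⟨(q, u), hu⟩ ∨ c = ⟨(v, q), hv'⟩ := by
    rintro ⟨⟨x, y⟩, hc⟩ hq
    simp only [Corner.face, Flag.face, Finset.mem_insert, Finset.mem_singleton] at hq
    rcases hq with rfl | rfl | rfl
    · exact absurd rfl npq
    · left
      obtain rfl : y = u := S.tri_unique hc hu
      rfl
    · right
      obtain rfl : x = v := S.tri_unique (S.tri_rotate (S.tri_rotate hc)) hv
      rfl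
  have hpqf : ∀ t : S.Face, (∀ k, (fl k).face ≠ t) ↔ (q ∈ t.1 → p ∉ t.1) := by
    intro t
    constructor
    · intro h hq hp
      obtain ⟨c, rfl⟩ := Face.exists_corner hp
      rcases hcorner c hq with rfl | rfl
      · exact h false rfl
      · exact h true fv.symm
    · rintro h (_ | _) rfl
      · exact h (by simp [fl, Flag.face]) (by simp [fl, Flag.face])
      · exact h (by simp [fl, Flag.face]) (by simp [fl, Flag.face])
  rw [D.sum_stringCoeff_mix hed hsep hfl hpqe hpqf s t h₀₁ h₁₂ σ₂ σ₀ hE hV, sum_piFinset_unit]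
  have hI : Φ₁.val (ed ()) = D.deg (σ₂.edge ⟨(q, p), hqp⟩) + D.deg s := by
    have := h₁₂.val_side ⟨q, hqp⟩
    rw [σ₂.deg_edge]
    exact (sub_eq_iff_eq_add.mp this.symm)
  rw [hI]
  simp only [edgeCoeff]
  -- It remains to compare summands for fixed labels `x`, `c`, `c'` of the common edge and its two
  -- ends.
  rw [← sum_mul_sum_pull]
  refine Finset.sum_congr rfl fun x _ => ?_
  rw [sum_piFinset_bool]
  have hP₁ : ∀ h, D.patchEdge ed (D.mixEdge q σ₂.edge σ₀.edge) (fun _ => x) ⟨(q, p), h⟩ = x :=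
    fun _ => D.patchEdge_apply hed _ _ ()
  have hP₂ : ∀ h, D.patchEdge ed (D.mixEdge q σ₂.edge σ₀.edge) (fun _ => x) ⟨(p, q), h⟩ =
      D.dual x := fun _ => D.patchEdge_symm hed hsep _ _ ()
  have hP₃ : ∀ e : S.OEdge, (e.fst = q ∨ e.snd = q) → e.fst ≠ p → e.snd ≠ p →
      D.patchEdge ed (D.mixEdge q σ₂.edge σ₀.edge) (fun _ => x) e = σ₂.edge e := by
    intro e he h₁ h₂
    have := (hpqe e).mpr fun _ => ⟨h₁, h₂⟩
    rw [D.patchEdge_of_ne _ _ this.1 this.2, mixEdge, if_pos he]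
  have hP₄ : ∀ e : S.OEdge, e.fst ≠ q → e.snd ≠ q →
      D.patchEdge ed (D.mixEdge q σ₂.edge σ₀.edge) (fun _ => x) e = σ₀.edge e := by
    intro e h₁ h₂
    have := (hpqe e).mpr fun h => absurd h (by tauto)
    rw [D.patchEdge_of_ne _ _ this.1 this.2, mixEdge, if_neg (by tauto)]
  have hδ₁ : D.δ (D.patchEdge ed (D.mixEdge q σ₂.edge σ₀.edge) (fun _ => x) (fl false).e₁)
      (D.patchEdge ed (D.mixEdge q σ₂.edge σ₀.edge) (fun _ => x) (fl false).e₂)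
      (D.patchEdge ed (D.mixEdge q σ₂.edge σ₀.edge) (fun _ => x) (fl false).e₃) =
      D.δ (D.dual x) (D.dual (σ₂.edge ⟨(u, q), huq⟩)) (σ₀.edge ⟨(u, p), hup⟩) := by
    congr 1
    · exact hP₂ _
    · exact (hP₃ ⟨(q, u), huq.symm⟩ (Or.inl rfl) npq.symm nup).trans (σ₂.edge_symm ⟨(u, q), huq⟩)
    · exact hP₄ ⟨(u, p), hup⟩ nuq npq
  have hδ₂ : D.δ (D.patchEdge ed (D.mixEdge q σ₂.edge σ₀.edge) (fun _ => x) (fl true).e₁)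
      (D.patchEdge ed (D.mixEdge q σ₂.edge σ₀.edge) (fun _ => x) (fl true).e₂)
      (D.patchEdge ed (D.mixEdge q σ₂.edge σ₀.edge) (fun _ => x) (fl true).e₃) =
      D.δ x (D.dual (σ₀.edge ⟨(v, p), hvp⟩)) (σ₂.edge ⟨(v, q), hvq⟩) := by
    congr 1
    · exact hP₁ _
    · exact (hP₄ ⟨(p, v), hvp.symm⟩ npq nvq).trans (σ₀.edge_symm ⟨(v, p), hvp⟩)
    · exact hP₃ ⟨(v, q), hvq⟩ (Or.inr rfl) nvp npq.symm
  rw [hδ₁, hδ₂]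
  refine Finset.sum_congr rfl fun c _ => Finset.sum_congr rfl fun c' _ => ?_
  have hU₁ : patchVert fl (mixVert q σ₂.vert σ₀.vert) (fun k => cond k c' c)
      (Flag.face ⟨(p, q, u), hu⟩) = c := patchVert_apply hfl _ _ false
  have hU₂ : patchVert fl (mixVert q σ₂.vert σ₀.vert) (fun k => cond k c' c)
      (Flag.face ⟨(q, p, v), hv⟩) = c' := patchVert_apply hfl _ _ true
  congr 1
  · rw [D.loopCoeff_corner_split hu hv' hqp hup hvp]
    have hR : ∀ w : S.Side p, w ≠ ⟨q, hqp⟩ → D.patchEdge ed (D.mixEdge q σ₂.edge σ₀.edge)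
        (fun _ => x) w.edge = σ₀.edge w.edge := fun w hw =>
      hP₄ _ (fun h => hw (Subtype.ext h)) npq
    have hout : ∀ c : S.Corner p, c ≠ ⟨(q, u), hu⟩ → c ≠ ⟨(v, q), hv'⟩ →
        q ∉ c.face.1 := fun c h₁ h₂ hq => (hcorner c hq).elim h₁ h₂
    have hset : (fun w : S.Side p => if w = ⟨q, hqp⟩ then {0} else
        Icc 1 (D.δ (σ₂.edge w.edge) s (D.dual (D.patchEdge ed (D.mixEdge q σ₂.edge σ₀.edge)
          (fun _ => x) w.edge)))) = fun w : S.Side p => if w = ⟨q, hqp⟩ then {0} else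
        Icc 1 (D.δ (σ₂.edge w.edge) s (D.dual (σ₀.edge w.edge))) := by
      funext w
      split_ifs with hw
      · rfl
      · rw [hR w hw]
    rw [hset]
    refine Finset.sum_congr rfl fun a _ => ?_
    congr 1
    · refine D.loopRest_congr (Corner.inEquiv S p) (Corner.outEquiv S p) (e := ⟨q, hqp⟩) rfl rfl
        (fun c h₁ h₂ => ?_) (fun _ _ => rfl) hR (fun _ _ _ => rfl) (fun c h₁ h₂ => ?_) a
      · have hq := Flag.off_of_notMem (hout c h₁ h₂) c.outer.symm (Or.inr (Or.inl rfl))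
        exact hE _ c.outer_off.1 c.outer_off.2 hq.2 hq.1
      · have hq := hout c h₁ h₂
        change patchVert fl _ _ c.face = _
        rw [patchVert_of_ne _ _ ((hpqf _).mpr fun h => absurd h hq), mixVert, if_neg hq]
    · have o₁ : σ₂.edge (Corner.outer (⟨(q, u), hu⟩ : S.Corner p)) = σ₂.edge ⟨(u, q), huq⟩ := rfl
      have o₂ : σ₂.edge (Corner.outer (⟨(v, q), hv'⟩ : S.Corner p)) =
          D.dual (σ₂.edge ⟨(v, q), hvq⟩) := σ₂.edge_symm ⟨(v, q), hvq⟩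
      rw [hP₁, fv, hU₁, hU₂, o₁, o₂, hP₄ ⟨(u, p), hup⟩ nuq npq, hP₄ ⟨(v, p), hvp⟩ nvq npq]
  · rw [D.loopCoeff_corner_split hv hu' hpq hvq huq]
    have hR : ∀ w : S.Side q, w ≠ ⟨p, hpq⟩ → D.patchEdge ed (D.mixEdge q σ₂.edge σ₀.edge)
        (fun _ => x) w.edge = σ₂.edge w.edge := fun w hw =>
      hP₃ _ (Or.inr rfl) (fun h => hw (Subtype.ext h)) npq.symm
    have hout : ∀ c : S.Corner q, c ≠ ⟨(p, v), hv⟩ → c ≠ ⟨(u, p), hu'⟩ →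
        p ∉ c.face.1 := by
      intro c h₁ h₂ hp
      obtain ⟨c', hc'⟩ := Face.exists_corner hp
      have hq : q ∈ c'.face.1 := by rw [hc']; exact c.mem_face
      rcases hcorner c' hq with rfl | rfl
      · exact h₂ (Corner.face_injective (hc'.symm.trans fu.symm))
      · exact h₁ (Corner.face_injective (hc'.symm.trans fv))
    have hset : (fun w : S.Side q => if w = ⟨p, hpq⟩ then {0} else
        Icc 1 (D.δ (D.patchEdge ed (D.mixEdge q σ₂.edge σ₀.edge) (fun _ => x) w.edge) t
          (D.dual (σ₀.edge w.edge)))) = fun w : S.Side q => if w = ⟨p, hpq⟩ then {0} else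
        Icc 1 (D.δ (σ₂.edge w.edge) t (D.dual (σ₀.edge w.edge))) := by
      funext w
      split_ifs with hw
      · rfl
      · rw [hR w hw]
    rw [hset]
    refine Finset.sum_congr rfl fun b _ => ?_
    congr 1
    · refine D.loopRest_congr (Corner.inEquiv S q) (Corner.outEquiv S q) (e := ⟨p, hpq⟩) rfl rfl
        (fun _ _ _ => rfl) hR (fun _ _ => rfl) (fun c h₁ h₂ => ?_) (fun _ _ _ => rfl) b
      have hp := hout c h₁ h₂
      change patchVert fl _ _ c.face = _
      rw [patchVert_of_ne _ _ ((hpqf _).mpr fun _ => hp), mixVert, if_pos c.mem_face]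
    · have o₁ : σ₀.edge (Corner.outer (⟨(p, v), hv⟩ : S.Corner q)) = σ₀.edge ⟨(v, p), hvp⟩ := rfl
      have o₂ : σ₀.edge (Corner.outer (⟨(u, p), hu'⟩ : S.Corner q)) =
          D.dual (σ₀.edge ⟨(u, p), hup⟩) := σ₀.edge_symm ⟨(u, p), hup⟩
      have o₃ : σ₀.edge ⟨(p, q), hpq⟩ = D.dual (σ₀.edge ⟨(q, p), hqp⟩) :=
        σ₀.edge_symm ⟨(q, p), hqp⟩
      rw [hP₂, fu, hU₁, hU₂, o₁, o₂, o₃, hP₃ ⟨(v, q), hvq⟩ (Or.inr rfl) nvp npq.symm,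
        hP₃ ⟨(u, q), huq⟩ (Or.inr rfl) nup npq.symm]
      simp only [D.dual_dual, D.d_dual]

/-- The operators of different plaquettes commute, if both intermediate colorings are
admissible. -/
theorem sum_stringCoeff_comm {p q : V} (hpq : p ≠ q) (s t : D.A)
    {Φ₀ Φ₁ Φ₁' Φ₂ : S.Coloring G} (h₀₁ : IsShift q (D.deg t) Φ₀ Φ₁)
    (h₁₂ : IsShift p (D.deg s) Φ₁ Φ₂) (h₀₁' : IsShift p (D.deg s) Φ₀ Φ₁')
    (h₁₂' : IsShift q (D.deg t) Φ₁' Φ₂) (hΦ₁ : D.Admissible Φ₁) (hΦ₁' : D.Admissible Φ₁')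
    (σ₂ : D.State Φ₂) (σ₀ : D.State Φ₀) :
    ∑ σ₁ : D.State Φ₁, D.stringCoeff p s σ₂ σ₁ * D.stringCoeff q t σ₁ σ₀ =
      ∑ σ₁ : D.State Φ₁', D.stringCoeff q t σ₂ σ₁ * D.stringCoeff p s σ₁ σ₀ := by
  classical
  by_cases hagree : (∀ e : S.OEdge, e.fst ≠ p → e.snd ≠ p → e.fst ≠ q → e.snd ≠ q →
      σ₂.edge e = σ₀.edge e) ∧ ∀ t : S.Face, p ∉ t.1 → q ∉ t.1 → σ₂.vert t = σ₀.vert t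
  swap
  · rw [Finset.sum_eq_zero, Finset.sum_eq_zero]
    · intro σ₁ _
      rw [D.stringCoeff_eq, D.stringCoeff_eq]
      by_cases h : D.AgreeOff q σ₁ σ₂
      · by_cases h' : D.AgreeOff p σ₀ σ₁
        · exact absurd ⟨fun e h₁ h₂ h₃ h₄ => (h.1 e h₃ h₄).trans (h'.1 e h₁ h₂),
            fun t h₁ h₂ => (h.2 t h₂).trans (h'.2 t h₁)⟩ hagree
        · rw [if_neg h', mul_zero]
      · rw [if_neg h, zero_mul]
    · intro σ₁ _
      rw [D.stringCoeff_eq, D.stringCoeff_eq]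
      by_cases h : D.AgreeOff p σ₁ σ₂
      · by_cases h' : D.AgreeOff q σ₀ σ₁
        · exact absurd ⟨fun e h₁ h₂ h₃ h₄ => (h.1 e h₁ h₂).trans (h'.1 e h₃ h₄),
            fun t h₁ h₂ => (h.2 t h₁).trans (h'.2 t h₂)⟩ hagree
        · rw [if_neg h', mul_zero]
      · rw [if_neg h, zero_mul]
  obtain ⟨hE, hV⟩ := hagree
  have hE' : ∀ e : S.OEdge, e.fst ≠ q → e.snd ≠ q → e.fst ≠ p → e.snd ≠ p →
      σ₂.edge e = σ₀.edge e := fun e h₁ h₂ h₃ h₄ => hE e h₃ h₄ h₁ h₂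
  have hV' : ∀ t : S.Face, q ∉ t.1 → p ∉ t.1 → σ₂.vert t = σ₀.vert t :=
    fun t h₁ h₂ => hV t h₂ h₁
  by_cases hadj : S.graph.Adj p q
  swap
  · rw [D.sum_stringCoeff_of_not_adj hpq hadj s t h₀₁ h₁₂ σ₂ σ₀ hE hV,
      D.sum_stringCoeff_of_not_adj hpq.symm (fun h => hadj h.symm) t s h₀₁' h₁₂' σ₂ σ₀ hE' hV',
      mul_comm]
  obtain ⟨u, hu⟩ := hadj
  obtain ⟨v, hv⟩ := S.tri_opposite hu
  have hup : S.graph.Adj u p := ⟨_, S.tri_rotate (S.tri_rotate hu)⟩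
  have huq : S.graph.Adj u q := S.tri_opposite (S.tri_rotate hu)
  have hvp : S.graph.Adj v p := S.tri_opposite (S.tri_rotate hv)
  have hvq : S.graph.Adj v q := ⟨_, S.tri_rotate (S.tri_rotate hv)⟩
  rw [D.sum_stringCoeff_of_adj hu hv (S.tri_rotate hu) (S.tri_rotate hv) ⟨_, hv⟩ ⟨_, hu⟩ hup huq
      hvp hvq s t h₀₁ h₁₂ σ₂ σ₀ hE hV,
    D.sum_stringCoeff_of_adj hv hu (S.tri_rotate hv) (S.tri_rotate hu) ⟨_, hu⟩ ⟨_, hv⟩ hvq hvp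
      huq hup t s h₀₁' h₁₂' σ₂ σ₀ hE' hV', Finset.sum_comm]
  refine Finset.sum_congr rfl fun b _ => Finset.sum_congr rfl fun a _ => ?_
  have e₀ : σ₀.edge ⟨(p, q), ⟨_, hu⟩⟩ = D.dual (σ₀.edge ⟨(q, p), ⟨_, hv⟩⟩) :=
    σ₀.edge_symm ⟨(q, p), ⟨_, hv⟩⟩
  have e₂ : σ₂.edge ⟨(p, q), ⟨_, hu⟩⟩ = D.dual (σ₂.edge ⟨(q, p), ⟨_, hv⟩⟩) :=
    σ₂.edge_symm ⟨(q, p), ⟨_, hv⟩⟩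
  -- This degree is the value of the intermediate coloring on the common side; in `ht` it is that of
  -- the other order, on the reversed side.
  have hs : D.deg (σ₂.edge ⟨(q, p), ⟨_, hv⟩⟩) + D.deg s ∉ D.X := by
    have : Φ₂.val ⟨(q, p), ⟨_, hv⟩⟩ = _ := h₁₂.val_side ⟨q, ⟨_, hv⟩⟩
    rw [σ₂.deg_edge, this, sub_add_cancel]
    exact hΦ₁ _
  have ht : D.deg (D.dual (σ₂.edge ⟨(q, p), ⟨_, hv⟩⟩)) + D.deg t ∉ D.X := by
    have : Φ₂.val ⟨(p, q), ⟨_, hu⟩⟩ = _ := h₁₂'.val_side ⟨p, ⟨_, hu⟩⟩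
    rw [← e₂, σ₂.deg_edge, this, sub_add_cancel]
    exact hΦ₁' _
  rw [e₀, e₂, D.edgeCoeff_swap _ _ _ _ _ _ _ _ _ _ _ _ _ _ _ _ _ _ _ _ hs ht, mul_comm
    (D.loopRest _ _ _ _ _ _ _ _ _ _ a)]

theorem gradedPlaquetteOp_comm {p q : V} (hpq : p ≠ q) {g h : G}
    {Φ₀ Φ₁ Φ₁' Φ₂ : S.Coloring G} (h₀₁ : IsShift q h Φ₀ Φ₁)
    (h₁₂ : IsShift p g Φ₁ Φ₂) (h₀₁' : IsShift p g Φ₀ Φ₁')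
    (h₁₂' : IsShift q h Φ₁' Φ₂) (hΦ₁ : D.Admissible Φ₁) (hΦ₁' : D.Admissible Φ₁') :
    D.gradedPlaquetteOp p g Φ₁ Φ₂ ∘ₗ D.gradedPlaquetteOp q h Φ₀ Φ₁ =
      D.gradedPlaquetteOp q h Φ₁' Φ₂ ∘ₗ D.gradedPlaquetteOp p g Φ₀ Φ₁' := by
  unfold gradedPlaquetteOp
  simp only [sum_linearMap_comp, linearMap_comp_sum]
  rw [Finset.sum_comm]
  refine Finset.sum_congr rfl fun s hs => Finset.sum_congr rfl fun t ht => ?_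
  simp only [GradedLabels.mem_I] at hs ht
  subst hs ht
  rw [LinearMap.smul_comp, LinearMap.comp_smul, LinearMap.smul_comp, LinearMap.comp_smul,
    smul_smul, smul_smul, mul_comm (D.b s)]
  congr 1
  unfold stringOp
  rw [← Matrix.mulVecLin_mul, ← Matrix.mulVecLin_mul]
  congr 1
  ext σ₂ σ₀
  rw [Matrix.mul_apply, Matrix.mul_apply]
  exact D.sum_stringCoeff_comm hpq s t h₀₁ h₁₂ h₀₁' h₁₂' hΦ₁ hΦ₁' σ₂ σ₀

/-- For `p ≠ q`, each factor of one operator is moved past each factor of the other around the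
square of colorings `Φ`, `Φp`, `Φq`, `Φpq`. -/
theorem plaquetteOp_comm {Φ : S.Coloring G} (hΦ : D.Admissible Φ) {p q : V} {g h : G}
    (hg : D.GenericAt Φ p g) (hh : D.GenericAt Φ q h) :
    D.plaquetteOp Φ p g * D.plaquetteOp Φ q h = D.plaquetteOp Φ q h * D.plaquetteOp Φ p g := by
  by_cases hpq : p = q
  · subst hpq
    rw [D.plaquetteOp_eq hΦ hg hh]
  -- The given `h` need not make the doubly shifted coloring admissible; `k` does, and computes the
  -- same operator.
  obtain ⟨k, hk, hk', -⟩ := D.exists_genericAt hΦ hg.2 q Set.finite_empty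
  rw [D.plaquetteOp_eq hΦ hh hk]
  set Φp := Φ + S.plaquetteColoring (-g) p with hΦp
  set Φq := Φ + S.plaquetteColoring (-k) q with hΦq
  set Φpq := Φp + S.plaquetteColoring (-k) q with hΦpq
  have sp : IsShift p g Φp Φ := isShift_neg
  have sq : IsShift q k Φq Φ := isShift_neg
  have sp' : IsShift p (-g) Φ Φp := isShift_add
  have sq' : IsShift q (-k) Φ Φq := isShift_add
  have tq' : IsShift q (-k) Φp Φpq := isShift_add
  have tq : IsShift q k Φpq Φp := isShift_neg
  have tp' : IsShift p (-g) Φq Φpq := fun e => by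
    rw [tq' e, sp' e, sq' e]; abel
  have tp : IsShift p g Φpq Φq := by simpa using tp'.symm
  have ap : D.Admissible Φp := hg.2
  have aq : D.Admissible Φq := hk.2
  have apq : D.Admissible Φpq := hk'.2
  have c₁ := D.gradedPlaquetteOp_comm hpq sq sp' tp' tq hΦ apq
  have c₂ := D.gradedPlaquetteOp_comm hpq sq' tp' sp' tq' aq ap
  have c₃ := D.gradedPlaquetteOp_comm hpq tq sp tp sq ap aq
  have c₄ := D.gradedPlaquetteOp_comm hpq tq' tp sp sq' apq hΦ
  unfold plaquetteOp
  rw [← hΦp, ← hΦq, Module.End.mul_eq_comp, Module.End.mul_eq_comp]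
  calc _ = D.gradedPlaquetteOp p g Φp Φ ∘ₗ (D.gradedPlaquetteOp p (-g) Φ Φp ∘ₗ
        D.gradedPlaquetteOp q k Φq Φ) ∘ₗ D.gradedPlaquetteOp q (-k) Φ Φq := by
        simp only [LinearMap.comp_assoc]
    _ = (D.gradedPlaquetteOp p g Φp Φ ∘ₗ D.gradedPlaquetteOp q k Φpq Φp) ∘ₗ
        (D.gradedPlaquetteOp p (-g) Φq Φpq ∘ₗ D.gradedPlaquetteOp q (-k) Φ Φq) := by
        rw [c₁]
        simp only [LinearMap.comp_assoc]
    _ = D.gradedPlaquetteOp q k Φq Φ ∘ₗ (D.gradedPlaquetteOp p g Φpq Φq ∘ₗ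
        D.gradedPlaquetteOp q (-k) Φp Φpq) ∘ₗ D.gradedPlaquetteOp p (-g) Φ Φp := by
        rw [c₂, c₃]
        simp only [LinearMap.comp_assoc]
    _ = _ := by
        rw [c₄]
        simp only [LinearMap.comp_assoc]

end LWData

/-! ### Hermiticity -/

namespace TriangulatedSurface

open Finset

variable {V : Type*} {S : TriangulatedSurface V}

theorem UEdge.rep_edge (e : S.UEdge) : e.rep.edge = e.1 := Quot.out_eq e.1

/-- The unoriented edge of a side. -/
def Side.uedge {p : V} (w : S.Side p) : S.UEdge := ⟨w.edge.edge, w.edge.edge_mem⟩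

variable [Fintype V] {R : Type*} [CommMonoid R]

theorem prod_face_eq [DecidableEq V] (p : V) (f : S.Face → R) :
    ∏ t : S.Face, f t = (∏ c : S.Corner p, f c.face) * ∏ t : S.Face with p ∉ t.1, f t := by
  rw [← Finset.prod_filter_mul_prod_filter_not univ (fun t : S.Face => p ∈ t.1)]
  congr 1
  symm
  refine Finset.prod_nbij (fun c : S.Corner p => c.face) ?_ ?_ ?_ (fun _ _ => rfl)
  · intro c _
    simpa using c.mem_face
  · exact Corner.face_injective.injOn
  · intro t ht
    simp only [coe_filter, mem_univ, true_and, Set.mem_ofPred_eq] at ht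
    obtain ⟨c, hc⟩ := Face.exists_corner ht
    exact ⟨c, by simp, hc⟩

open Classical in
theorem prod_uedge_eq (p : V) (f : S.UEdge → R) :
    ∏ e : S.UEdge, f e = (∏ w : S.Side p, f w.uedge) * ∏ e : S.UEdge with p ∉ e.1, f e := by
  rw [← Finset.prod_filter_mul_prod_filter_not univ (fun e : S.UEdge => p ∈ e.1)]
  congr 1
  symm
  refine Finset.prod_nbij (fun w : S.Side p => w.uedge) ?_ ?_ ?_ (fun _ _ => rfl)
  · intro w _
    simp only [mem_filter, mem_univ, true_and]
    exact Sym2.mem_mk_right w.1 p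
  · intro w _ w' _ h
    have h' : s(w.1, p) = s(w'.1, p) := congrArg Subtype.val h
    exact Subtype.ext (Sym2.congr_left.mp h')
  · rintro ⟨e, he⟩ hp
    simp only [coe_filter, mem_univ, true_and, Set.mem_ofPred_eq] at hp
    obtain ⟨w, rfl⟩ := Sym2.mem_iff_exists.mp hp
    exact ⟨⟨w, he.symm⟩, by simp, Subtype.ext Sym2.eq_swap⟩

end TriangulatedSurface

namespace LWData

open TriangulatedSurface Finset

variable {𝕜 : Type*} [Field 𝕜] [StarRing 𝕜] {G : Type*} [AddCommGroup G] (D : LWData 𝕜 G)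

/-- The conjugation rule with the mirrored symbol brought back to the argument order of `loopCoeff`.
-/
theorem star_N_loop (s i i' j j' o : D.A) (a c c' a' : ℕ) :
    star (D.N i (D.dual s) i' (D.dual j') o (D.dual j) a c' c a') =
      D.N i' s i (D.dual j) o (D.dual j') a c c' a' *
        (D.γ i (D.dual s) (D.dual i') a * D.γ i' (D.dual j') (D.dual o) c' *
          D.γ o j (D.dual i) c * D.γ j' s (D.dual j) a' *
          (D.β i * D.β s * D.β i' * D.β j' * D.β o * D.β j)) := by
  rw [D.star_N, D.N_symm₁ (D.dual (D.dual s)), D.N_symm₁ (D.dual i), D.γ_rotate (D.dual i),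
    D.γ_rotate j' s]
  simp only [D.dual_dual, D.β_dual]
  ring

/-- Adjunction of the transfer matrices of `s` and `dual s` around a loop. -/
theorem loopCoeff_star {W K : Type*} [Fintype W] [DecidableEq W] [Fintype K] [DecidableEq K]
    (inn out : K ≃ W) (o : K → D.A) (s : D.A) (j' j : W → D.A) (C' C : K → ℕ) :
    (∏ k, D.γ (D.dual (j' (out k))) (D.dual (o k)) (j' (inn k)) (C' k)) * (∏ w, D.β (j' w)) /
        (∏ w, D.d (j' w)) * D.loopCoeff inn out o s j' j C' C =
      (∏ k, D.γ (D.dual (j (out k))) (D.dual (o k)) (j (inn k)) (C k)) * (∏ w, D.β (j w)) /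
        (∏ w, D.d (j w)) * star (D.loopCoeff inn out o (D.dual s) j j' C C') := by
  have hγ : ∀ (i : W → D.A) k n, D.γ (D.dual (i (out k))) (D.dual (o k)) (i (inn k)) n =
      D.γ (i (inn k)) (D.dual (i (out k))) (D.dual (o k)) n := fun i k n => (D.γ_rotate _ _ _ _).symm
  simp only [hγ]
  have hδ : ∀ w, D.δ (j w) (D.dual s) (D.dual (j' w)) = D.δ (j' w) s (D.dual (j w)) := fun w => by
    rw [D.δ_dual, D.dual_dual, D.dual_dual]
  simp only [loopCoeff, hδ]
  rw [star_sum, Finset.mul_sum, Finset.mul_sum]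
  refine Finset.sum_congr rfl fun a _ => ?_
  rw [star_prod]
  simp only [star_mul', D.star_d, D.star_N_loop]
  -- If a symbol vanishes, both sides do; otherwise its support gives the bounds under which
  -- `γ_theta` holds.
  by_cases hN : ∃ k, D.N (j' (inn k)) s (j (inn k)) (D.dual (j (out k))) (o k)
      (D.dual (j' (out k))) (a (inn k)) (C k) (C' k) (a (out k)) = 0
  · obtain ⟨k, hk⟩ := hN
    refine (mul_eq_zero_of_right _ (Finset.prod_eq_zero (mem_univ k) ?_)).trans
      (mul_eq_zero_of_right _ (Finset.prod_eq_zero (mem_univ k) ?_)).symm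
    · rw [hk, mul_zero]
    · rw [hk, zero_mul, mul_zero]
  push Not at hN
  -- `γ_theta` at every corner. The product of the `β(j)` occurs twice because each side meets two
  -- corners. `h₂` is `γ_theta` at the string vertex on every side.
  have h₁ : (∏ k, D.γ (j (inn k)) (D.dual (j (out k))) (D.dual (o k)) (C k)) *
      (∏ k, D.γ (o k) (j (out k)) (D.dual (j (inn k))) (C k)) * (∏ w, D.β (j w)) *
      (∏ w, D.β (j w)) * (∏ k, D.β (o k)) = 1 := by
    conv_lhs => rw [← inn.prod_comp (fun w => D.β (j w))]
    conv_lhs => enter [1, 2]; rw [inn.prod_comp (fun w => D.β (j w)),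
      ← out.prod_comp (fun w => D.β (j w))]
    simp only [← Finset.prod_mul_distrib]
    refine Finset.prod_eq_one fun k _ => ?_
    have hn := (D.N_ne_zero (hN k)).2.1
    have := D.γ_theta _ _ _ _ hn.1 hn.2
    simpa only [D.dual_dual, D.β_dual] using this
  have h₂ : (∏ w, D.γ (j' w) s (D.dual (j w)) (a w)) *
      (∏ w, D.γ (j w) (D.dual s) (D.dual (j' w)) (a w)) * (∏ w, D.β (j' w)) *
      (∏ _w : W, D.β s) * (∏ w, D.β (j w)) = 1 := by
    simp only [← Finset.prod_mul_distrib]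
    refine Finset.prod_eq_one fun w _ => ?_
    have hn := (D.N_ne_zero (hN (inn.symm w))).1
    rw [Equiv.apply_symm_apply] at hn
    have := D.γ_theta _ _ _ _ hn.1 hn.2
    simpa only [D.dual_dual, D.β_dual] using this
  have hd : ∀ i : W → D.A, ∏ w, D.d (i w) ≠ 0 := fun i =>
    Finset.prod_ne_zero_iff.mpr fun w _ => D.d_ne_zero _
  have hd' := hd j'
  have hd'' := hd j
  simp only [Finset.prod_mul_distrib]
  rw [inn.prod_comp (fun w => D.d (j' w)), inn.prod_comp (fun w => D.d (j w)),
    inn.prod_comp (fun w => D.β (j' w)), inn.prod_comp (fun w => D.β (j w)),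
    out.prod_comp (fun w => D.β (j' w)), out.prod_comp (fun w => D.β (j w)),
    inn.prod_comp (fun w => D.γ (j w) (D.dual s) (D.dual (j' w)) (a w)),
    out.prod_comp (fun w => D.γ (j' w) s (D.dual (j w)) (a w)),
    inn.prod_comp (fun _ => D.β s)]
  generalize (∏ k, D.N (j' (inn k)) s (j (inn k)) (D.dual (j (out k))) (o k)
      (D.dual (j' (out k))) (a (inn k)) (C k) (C' k) (a (out k))) = n
  generalize (∏ k, D.γ (j' (inn k)) (D.dual (j' (out k))) (D.dual (o k)) (C' k)) = g'
  generalize (∏ k, D.γ (j (inn k)) (D.dual (j (out k))) (D.dual (o k)) (C k)) = g at *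
  generalize (∏ k, D.γ (o k) (j (out k)) (D.dual (j (inn k))) (C k)) = ε at *
  generalize (∏ w, D.γ (j' w) s (D.dual (j w)) (a w)) = μ at *
  generalize (∏ w, D.γ (j w) (D.dual s) (D.dual (j' w)) (a w)) = ν at *
  generalize (∏ w, D.β (j' w)) = b' at *
  generalize (∏ w, D.β (j w)) = b at *
  generalize (∏ _w : W, D.β s) = bs at *
  generalize (∏ k, D.β (o k)) = bo at *
  generalize (∏ w, D.d (j' w)) = d' at *
  generalize (∏ w, D.d (j w)) = d₀ at *
  field_simp
  linear_combination (-(g' * b' * n)) * h₂ - g' * b' * n * (μ * ν * b' * bs * b) * h₁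

variable {V : Type*} [DecidableEq V] {S : TriangulatedSurface V} [Fintype V]

theorem State.prod_edge_eq {D : LWData 𝕜 G} {Φ : S.Coloring G} (σ : D.State Φ) (p : V)
    {f : D.A → 𝕜} (hf : ∀ a, f (D.dual a) = f a) :
    ∏ e : S.UEdge, f (σ.edge e.rep) = (∏ w : S.Side p, f (σ.edge w.edge)) *
      open Classical in ∏ e : S.UEdge with p ∉ e.1, f (σ.edge e.rep) := by
  rw [prod_uedge_eq p]
  congr 1
  swap
  · refine Finset.prod_congr ?_ fun _ _ => rfl
    ext e
    simp
  refine Finset.prod_congr rfl fun w _ => ?_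
  rcases (SimpleGraph.dart_edge_eq_iff _ _).mp w.uedge.rep_edge with h | h
  · rw [h]
  · rw [h, σ.edge_symm, hf]

theorem State.prod_face_flagγ {D : LWData 𝕜 G} {Φ : S.Coloring G} (σ : D.State Φ) (p : V) :
    ∏ t : S.Face, σ.flagγ t.rep = (∏ c : S.Corner p, σ.flagγ c.flag) *
      ∏ t : S.Face with p ∉ t.1, σ.flagγ t.rep := by
  rw [prod_face_eq p]
  congr 1
  exact Finset.prod_congr rfl fun c _ => σ.flagγ_eq c.face.rep_face

/-- Entrywise form of the adjointness of `B_p^s` and `B_p^{s*}`. The weight factors away from the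
boundary of `p` agree for the two states; those on it are handled by `loopCoeff_star`. -/
theorem weight_mul_stringCoeff (p : V) (s : D.A) {Φ Φ' : S.Coloring G} (σ' : D.State Φ')
    (σ : D.State Φ) : σ'.weight * D.stringCoeff p s σ' σ =
      star (D.stringCoeff p (D.dual s) σ σ') * σ.weight := by
  classical
  rw [D.stringCoeff_eq, D.stringCoeff_eq]
  by_cases h : D.AgreeOff p σ σ'
  swap
  · rw [if_neg h, if_neg fun h' => h h'.symm, star_zero, mul_zero, zero_mul]
  rw [if_pos h, if_pos h.symm]
  unfold State.weight
  rw [σ.prod_face_flagγ p, σ'.prod_face_flagγ p, σ.prod_edge_eq p D.β_dual,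
    σ'.prod_edge_eq p D.β_dual, σ.prod_edge_eq p D.d_dual, σ'.prod_edge_eq p D.d_dual]
  have hedge : ∀ e : S.UEdge, p ∉ e.1 → σ'.edge e.rep = σ.edge e.rep := by
    intro e he
    rw [← e.rep_edge] at he
    refine h.1 _ ?_ ?_
    · rintro hp
      exact he (hp ▸ Sym2.mem_mk_left _ _)
    · rintro hp
      exact he (hp ▸ Sym2.mem_mk_right _ _)
  have hβ : ∀ f : D.A → 𝕜, ∏ e : S.UEdge with p ∉ e.1, f (σ'.edge e.rep) =
      ∏ e : S.UEdge with p ∉ e.1, f (σ.edge e.rep) := fun f =>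
    Finset.prod_congr rfl fun e he => by rw [hedge e (by simpa using he)]
  have hγ : ∏ t : S.Face with p ∉ t.1, σ'.flagγ t.rep =
      ∏ t : S.Face with p ∉ t.1, σ.flagγ t.rep := by
    refine Finset.prod_congr rfl fun t ht => ?_
    have hp : p ∉ t.rep.face.1 := by
      rw [t.rep_face]
      simpa using ht
    have hoff := Flag.off_of_notMem hp
    have he : ∀ e, e = t.rep.e₁ ∨ e = t.rep.e₂ ∨ e = t.rep.e₃ → σ'.edge e = σ.edge e :=
      fun e he => h.1 e (hoff e he).1 (hoff e he).2
    rw [State.flagγ, State.flagγ, h.2 _ hp, he _ (Or.inl rfl), he _ (Or.inr (Or.inl rfl)),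
      he _ (Or.inr (Or.inr rfl))]
  rw [hβ, hβ, hγ]
  have hflag : ∀ {Ψ : S.Coloring G} (τ : D.State Ψ),
      (∀ c : S.Corner p, τ.edge c.outer = σ.edge c.outer) →
      ∏ c : S.Corner p, τ.flagγ c.flag = ∏ c : S.Corner p,
        D.γ (D.dual (τ.edge (Corner.outEquiv S p c).edge)) (D.dual (σ.edge c.outer))
          (τ.edge (Corner.inEquiv S p c).edge) (τ.vert c.face) := by
    intro Ψ τ hτ
    refine Finset.prod_congr rfl fun c _ => ?_
    rw [State.flagγ, Corner.flag_e₁, Corner.flag_e₂, Corner.flag_e₃, τ.edge_symm, τ.edge_symm,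
      hτ c]
    rfl
  have hout : ∀ c : S.Corner p, σ'.edge c.outer = σ.edge c.outer :=
    fun c => h.1 _ c.outer_off.1 c.outer_off.2
  rw [hflag σ' hout, hflag σ fun _ => rfl]
  simp only [hout]
  have key := D.loopCoeff_star (Corner.inEquiv S p) (Corner.outEquiv S p)
    (fun c => σ.edge c.outer) s (fun w => σ'.edge w.edge) (fun w => σ.edge w.edge)
    (fun c => σ'.vert c.face) (fun c => σ.vert c.face)
  have hsplit : ∀ g r b r' d r'' : 𝕜,
      (g * r) * (b * r') / (d * r'') = (g * b / d) * (r * r' / r'') := fun _ _ _ _ _ _ => by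
    rw [mul_mul_mul_comm, mul_div_mul_comm]
  rw [hsplit, hsplit, mul_right_comm, key]
  ring

theorem form_stringOp (p : V) (s : D.A) {Φ Φ' : S.Coloring G} (ψ : D.StateSpace Φ')
    (φ : D.StateSpace Φ) :
    D.form ψ (D.stringOp p s Φ Φ' φ) = D.form (D.stringOp p (D.dual s) Φ' Φ ψ) φ := by
  simp only [form, stringOp, Matrix.mulVecLin_apply, Matrix.mulVec, dotProduct, Matrix.of_apply,
    star_sum, star_mul', Finset.mul_sum, Finset.sum_mul]
  rw [Finset.sum_comm]
  refine Finset.sum_congr rfl fun σ _ => Finset.sum_congr rfl fun σ' _ => ?_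
  linear_combination (star (ψ σ') * φ σ) * D.weight_mul_stringCoeff p s σ' σ

theorem form_sum_right {ι : Type*} (t : Finset ι) {Φ : S.Coloring G} (ψ : D.StateSpace Φ)
    (φ : ι → D.StateSpace Φ) (c : ι → 𝕜) :
    D.form ψ (∑ i ∈ t, c i • φ i) = ∑ i ∈ t, c i * D.form ψ (φ i) := by
  simp only [form, Finset.sum_apply, Pi.smul_apply, smul_eq_mul, Finset.mul_sum]
  rw [Finset.sum_comm]
  exact Finset.sum_congr rfl fun i _ => Finset.sum_congr rfl fun σ _ => by ring

theorem form_sum_left {ι : Type*} (t : Finset ι) {Φ : S.Coloring G} (ψ : ι → D.StateSpace Φ)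
    (φ : D.StateSpace Φ) (c : ι → 𝕜) :
    D.form (∑ i ∈ t, c i • ψ i) φ = ∑ i ∈ t, star (c i) * D.form (ψ i) φ := by
  simp only [form, Finset.sum_apply, Pi.smul_apply, smul_eq_mul, Finset.mul_sum, star_sum,
    star_mul', Finset.sum_mul]
  rw [Finset.sum_comm]
  exact Finset.sum_congr rfl fun i _ => Finset.sum_congr rfl fun σ _ => by ring

/-- Duality exchanges the labels of degrees `g` and `-g`, and the weights `b` are fixed by duality
and by the bar. -/
theorem form_gradedPlaquetteOp (p : V) (g : G) {Φ Φ' : S.Coloring G} (ψ : D.StateSpace Φ')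
    (φ : D.StateSpace Φ) :
    D.form ψ (D.gradedPlaquetteOp p g Φ Φ' φ) = D.form (D.gradedPlaquetteOp p (-g) Φ' Φ ψ) φ := by
  unfold gradedPlaquetteOp
  rw [D.sum_I_dual (-g), neg_neg]
  simp only [LinearMap.sum_apply, LinearMap.smul_apply, D.b_dual]
  rw [D.form_sum_right, D.form_sum_left]
  simp only [D.star_b, D.form_stringOp]

theorem form_plaquetteOp (p : V) (g : G) {Φ : S.Coloring G} (ψ φ : D.StateSpace Φ) :
    D.form ψ (D.plaquetteOp Φ p g φ) = D.form (D.plaquetteOp Φ p g ψ) φ := by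
  simp only [plaquetteOp, LinearMap.comp_apply]
  rw [D.form_gradedPlaquetteOp, D.form_gradedPlaquetteOp, neg_neg]

end LWData

/-- For each plaquette `p` there is a generic `g`; `B_p = B_p^g B_p^{-g}` does not depend on it;
`B_p` is a projector; plaquette operators commute; they are Hermitian for the indefinite form. -/
theorem mainTheorem8 {𝕜 : Type*} [Field 𝕜] [StarRing 𝕜] {G : Type*} [AddCommGroup G]
    (D : LWData 𝕜 G) {V : Type*} [Fintype V] [DecidableEq V] (S : TriangulatedSurface V)
    (Φ : S.Coloring G) (hΦ : D.Admissible Φ) :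
    (∀ p : V, ∃ g : G, D.GenericAt Φ p g) ∧
    (∀ (p : V) (g g' : G), D.GenericAt Φ p g → D.GenericAt Φ p g' →
      D.plaquetteOp Φ p g = D.plaquetteOp Φ p g') ∧
    (∀ (p : V) (g : G), D.GenericAt Φ p g →
      D.plaquetteOp Φ p g * D.plaquetteOp Φ p g = D.plaquetteOp Φ p g) ∧
    (∀ (p p' : V) (g g' : G), D.GenericAt Φ p g → D.GenericAt Φ p' g' →
      D.plaquetteOp Φ p g * D.plaquetteOp Φ p' g' =
        D.plaquetteOp Φ p' g' * D.plaquetteOp Φ p g) ∧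
    (∀ (p : V) (g : G), D.GenericAt Φ p g → ∀ ψ φ : D.StateSpace Φ,
      D.form ψ (D.plaquetteOp Φ p g φ) = D.form (D.plaquetteOp Φ p g ψ) φ) := by
  refine ⟨fun p => ?_, fun p g g' hg hg' => D.plaquetteOp_eq hΦ hg hg',
    fun p g hg => D.plaquetteOp_mul_self hΦ hg,
    fun p p' g g' hg hg' => D.plaquetteOp_comm hΦ hg hg',
    fun p g _ ψ φ => D.form_plaquetteOp p g ψ φ⟩
  obtain ⟨g, hg, -⟩ := D.exists_genericAt hΦ hΦ p Set.finite_empty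
  exact ⟨g, hg⟩
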